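/- Conventions. Let $(X,d)$ be a geodesic metric space (not assumed proper or separable), $o\in X$ a basepoint, and $G$ a countable group acting on $X$ by isometries. For $x,y,z\in X$ let $$(y,z)_x := \tfrac12\big(d(x,y)+d(x,z)-d(y,z)\big)$$ be the Gromov product of $y$ and $z$ based at $x$. For $A\subseteq X$ and $x \in X$ let $\pi_A(x)=\{a\in A: d(x,a)=d(x,A)\}$. For $K>0$, the set $A$ is $K$-contracting if $\pi_A(z)\neq\emptyset$ for all $z\in X$ and $\operatorname{diam}(\pi_A(x)\cup\pi_A(y))\le K$ whenever $x,y \in X$ satisfy $d(x,y)\le d(x,A)-K$. An element $g\in G$ is a contracting isometry if for some $K>0$ the orbit map $n\in\mathbb Z\mapsto g^n o$ is a $K$-quasigeodesic, i.e. $\frac1K|m-n|-K\le d(g^mo,g^no)\le K|m-n|+K$ for all $m,n\in\mathbb Z$, whose image is $K$-contracting. Two elements $g,h \in G$ are independent if $\{(n,m)\in\mathbb Z^2: d(g^no,h^mo)<M\}$ is bounded for every $M>0$. Let $\mu$ be a probability measure on $G$ (with the discrete $\sigma$-algebra) which is non-elementary: the semigroup $\{g_1\cdots g_n : n\ge 0,\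 \mu(g_i)>0\}$ contains two independent contracting isometries (in particular, so does $G$). Let $(g_n)_{n\in\mathbb Z}$ be distributed according to the product measure $\mu^{\mathbb Z}$ on $G^{\mathbb Z}$, and for $n\ge 0$ put $$\omega_n=g_1g_2\cdots g_n,\qquad \check\omega_n=\omega_{-n}=g_0^{-1}g_{-1}^{-1}\cdots g_{-n+1}^{-1}\qquad(\omega_0=\check\omega_0=\mathrm{id}).$$ Theorem (Deviation inequality). (1) If $\mu$ has finite $p$-th moment for some $p>0$, i.e. $\int_G d(o,go)^p\,d\mu(g)<\infty$, then there exists $K>0$ such that for every $x\in X$ $$\mathbb E\Big[\sup_{n\ge0}(\omega_no,x)_o^{\,p}\Big]<K,\qquad \mathbb E\Big[\sup_{n,n'\ge0}(\check\omega_{n'}o,\omega_no)_o^{\,2p}\Big]<K.$$ (2) If $\mu$ has finite exponential moment, i.e. $\int_G e^{c\,d(o,go)}\,d\mu(g)<\infty$ for some $c>0$, then there exist $\kappa,K>0$ such that for every $x\in X$ $$\mathbb E\Big[\sup_{n\ge0}e^{\kappa (x,\omega_no)_o}\Big]<K,\qquad \mathbb E\Big[\sup_{n,n'\ge0}e^{\kappa(\check\omega_{n'}o,\omega_no)_o}\Big]<K.$$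 -/

import Mathlib

open MeasureTheory
open scoped ENNReal

noncomputable section

namespace ContractingWalk

/-- A metric space is geodesic if any two points are joined by an isometrically embedded
segment of length equal to their distance. -/
def IsGeodesicSpace (X : Type*) [MetricSpace X] : Prop :=
  ∀ x y : X, ∃ γ : ℝ → X, γ 0 = x ∧ γ (dist x y) = y ∧
    ∀ s ∈ Set.Icc (0 : ℝ) (dist x y), ∀ t ∈ Set.Icc (0 : ℝ) (dist x y),
      dist (γ s) (γ t) = |s - t|

/-- The Gromov product `(y, z)_x` of `y` and `z` based at `x`. -/
def gromovProduct {X : Type*} [MetricSpace X] (x y z : X) : ℝ :=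
  (dist x y + dist x z - dist y z) / 2

/-- The closest point projection of `x` to `A`, as a set. -/
def closestPoints {X : Type*} [MetricSpace X] (A : Set X) (x : X) : Set X :=
  {a | a ∈ A ∧ dist x a = Metric.infDist x A}

/-- `K`-contracting subsets of a metric space. -/
def IsContractingSet {X : Type*} [MetricSpace X] (K : ℝ) (A : Set X) : Prop :=
  (∀ z : X, (closestPoints A z).Nonempty) ∧
  ∀ x y : X, dist x y ≤ Metric.infDist x A - K →
    Metric.ediam (closestPoints A x ∪ closestPoints A y) ≤ ENNReal.ofReal K

/-- `K`-quasigeodesics parametrized by the integers. -/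
def IsQuasigeodesic {X : Type*} [MetricSpace X] (K : ℝ) (γ : ℤ → X) : Prop :=
  ∀ m n : ℤ, |(m : ℝ) - n| / K - K ≤ dist (γ m) (γ n) ∧
    dist (γ m) (γ n) ≤ K * |(m : ℝ) - n| + K

/-- A (bi-infinite) `K`-contracting axis: a `K`-quasigeodesic whose image is `K`-contracting. -/
def IsContractingAxis {X : Type*} [MetricSpace X] (K : ℝ) (γ : ℤ → X) : Prop :=
  IsQuasigeodesic K γ ∧ IsContractingSet K (Set.range γ)

/-- `g` is a contracting isometry: for some `K > 0` its orbit `n ↦ gⁿ o` is a `K`-contracting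
axis. -/
def IsContractingIsometry {X G : Type*} [MetricSpace X] [Group G] [MulAction G X]
    (o : X) (g : G) : Prop :=
  ∃ K : ℝ, 0 < K ∧ IsContractingAxis K (fun n : ℤ => g ^ n • o)

/-- Bi-infinite paths are independent if `(n, m) ↦ d(κ n, η m)` is proper. -/
def IndependentPaths {X : Type*} [MetricSpace X] (κ η : ℤ → X) : Prop :=
  ∀ M : ℝ, 0 < M → Bornology.IsBounded {q : ℤ × ℤ | dist (κ q.1) (η q.2) < M}

/-- Isometries are independent if their orbits are. -/
def IndependentIsometries {X G : Type*} [MetricSpace X] [Group G] [MulAction G X]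
    (o : X) (g h : G) : Prop :=
  IndependentPaths (fun n : ℤ => g ^ n • o) (fun n : ℤ => h ^ n • o)

/-- `μ` is non-elementary: the semigroup generated by its support (the elements of positive
mass) contains two independent contracting isometries. The empty product is allowed, so this
semigroup is a submonoid. -/
def IsNonElementary {X G : Type*} [MetricSpace X] [Group G] [MulAction G X] [MeasurableSpace G]
    (o : X) (μ : Measure G) : Prop :=
  ∃ a ∈ Submonoid.closure {g : G | μ {g} ≠ 0},
    ∃ b ∈ Submonoid.closure {g : G | μ {g} ≠ 0},
      IsContractingIsometry o a ∧ IsContractingIsometry o b ∧ IndependentIsometries o a b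

/-- Finite `p`-th moment: `∫ d(o, g o)^p dμ(g) < ∞`. -/
def HasFiniteMoment {X G : Type*} [MetricSpace X] [Group G] [MulAction G X] [MeasurableSpace G]
    (o : X) (μ : Measure G) (p : ℝ) : Prop :=
  ∫⁻ g, ENNReal.ofReal (dist o (g • o) ^ p) ∂μ < ∞

/-- Finite exponential moment: `∫ exp(c d(o, g o)) dμ(g) < ∞` for some `c > 0`. -/
def HasFiniteExpMoment {X G : Type*} [MetricSpace X] [Group G] [MulAction G X]
    [MeasurableSpace G] (o : X) (μ : Measure G) : Prop :=
  ∃ c : ℝ, 0 < c ∧ ∫⁻ g, ENNReal.ofReal (Real.exp (c * dist o (g • o))) ∂μ < ∞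

/-- The step space `(G^ℤ, μ^ℤ)`: the product measure on bi-infinite step paths. -/
def stepMeasure {G : Type*} [MeasurableSpace G] (μ : Measure G) [IsProbabilityMeasure μ] :
    Measure (ℤ → G) :=
  Measure.infinitePi (fun _ : ℤ => μ)

/-- The forward walk `ω_n = g_1 g_2 ⋯ g_n`. -/
def forwardWalk {G : Type*} [Group G] (g : ℤ → G) (n : ℕ) : G :=
  ((List.range n).map (fun i : ℕ => g ((i : ℤ) + 1))).prod

/-- The backward walk `ω̌_n = ω_{-n} = g_0⁻¹ g_{-1}⁻¹ ⋯ g_{-n+1}⁻¹`. -/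
def backwardWalk {G : Type*} [Group G] (g : ℤ → G) (n : ℕ) : G :=
  ((List.range n).map (fun i : ℕ => (g (-(i : ℤ)))⁻¹)).prod

end ContractingWalk

end

/-!
# Deviation inequalities for random walks with contracting isometries

*Idea.* A gate is a pair of distant points `c, c'` of a contracting set. If `x` projects near `c`
and `y` projects near `c'`, every geodesic from `x` to `y` passes near `c` and then near `c'`.
Hence, if a gate `(ω_i o, ω_i' o)` with `i, i' ≤ m` separates `x` from `ω_n o`, then
`(ω_n o, x)_o` is bounded by the displacement `d(o, ω_i o)` up to a constant, hence by the sum of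
the displacements of the first `m` steps. It remains to find such gates for all `n` simultaneously,
outside of an event whose probability is exponentially small in `m`.

*Existence of gates.* Since the measure is non-elementary, there are words of a common length
and positive probability which spell `b ^ (j * s) * a ^ n * b ^ ((50 - j) * s)`, for `j < 50`, where
`a` and `b` are independent contracting isometries (`exists_schottkySystem`). The `j`-th word
carries a translate of the axis of `a`, and by Behrstock's inequality a given point can spoil at
most one of these fifty axes. Cut the walk into blocks of this length. A block that spells one of
the words creates a gate between given past points and given future points unless they spoil its
word. Past points only depend on earlier steps, but future points only depend on later ones, so
that the blocks cannot be revealed one after the other. Instead, each block receives a weight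
for the past and a weight for the future, such that the product of the two is at least `1` if the
block creates no gate, although each family of weights, integrated in its own direction of time, has
exponentially small product (`setLIntegral_no_gate_le`). So one of two exponentially
unlikely events occurs if none of the blocks in a window creates a gate.

*From one time to all times.* A union bound over all `n` is only available for the polynomially
many `n` comparable to the size of the window. The others are reached by chaining over dyadic
scales (`ScaleSeparated.exists_separates`): the gate at scale `2r` lies at times comparable to `r`,
so it is seen through the gate at scale `r`; the errors do not accumulate, since
`IsGate.dist_add_dist_le` has an error that does not depend on the one in its hypothesis. For the
two-sided statement, gates of the forward walk and of the backward walk are combined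
(`exists_dist_add_dist_le_of_scaleSeparated`), and the Gromov product is bounded both by a sum over
positive times and by a sum over nonpositive times.

*Moments.* The bounds on bad events hold conditionally on any two steps. This makes it
possible to bound the `p`-th moment of the sum of displacements up to a random time without losing
any integrability (`exists_lintegral_le_mul_of_bad`); in the two-sided case the product of two
independent steps has a `p`-th moment, which gives the exponent `2p`. Exponential moments follow
from the Cauchy–Schwarz inequality (`exists_lintegral_le_of_bad`).
-/

/-! ### Projections to contracting sets -/

namespace ContractingWalk

section ContractingSets

variable {X : Type*} [MetricSpace X]

theorem mem_closestPoints_self {A : Set X} {a : X} (ha : a ∈ A) : a ∈ closestPoints A a :=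
  ⟨ha, by rw [dist_self, Metric.infDist_zero_of_mem ha]⟩

theorem dist_le_of_mem_closestPoints {A : Set X} {x p a : X} (hp : p ∈ closestPoints A x)
    (ha : a ∈ A) : dist x p ≤ dist x a :=
  hp.2.trans_le (Metric.infDist_le_dist_of_mem ha)

/-- A closest point of `x` is also a closest point of every point between `x` and it. -/
theorem mem_closestPoints_of_between {A : Set X} {x z p : X} (hp : p ∈ closestPoints A x)
    (hz : dist x z + dist z p = dist x p) : p ∈ closestPoints A z := by
  refine ⟨hp.1, le_antisymm ?_ (Metric.infDist_le_dist_of_mem hp.1)⟩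
  have h := Metric.infDist_le_infDist_add_dist (s := A) (x := x) (y := z)
  linarith [hp.2]

theorem IsContractingSet.dist_le {K : ℝ} {A : Set X} (hA : IsContractingSet K A) (hK : 0 < K)
    {x y p q : X} (hp : p ∈ closestPoints A x) (hq : q ∈ closestPoints A y)
    (h : dist x y ≤ Metric.infDist x A - K) : dist p q ≤ K := by
  have h1 := Metric.edist_le_ediam_of_mem (s := closestPoints A x ∪ closestPoints A y)
    (Or.inl hp) (Or.inr hq)
  have h2 := h1.trans (hA.2 x y h)
  rwa [edist_dist, ENNReal.ofReal_le_ofReal_iff hK.le] at h2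

theorem IsContractingSet.mono {K K' : ℝ} {A : Set X} (hA : IsContractingSet K A)
    (h : K ≤ K') : IsContractingSet K' A :=
  ⟨hA.1, fun x y hxy => (hA.2 x y (by linarith)).trans (ENNReal.ofReal_le_ofReal h)⟩

/-- Along a path that is `1`-Lipschitz and stays at distance at least `3K` from a `K`-contracting
set, projections move at most at half speed. -/
theorem IsContractingSet.dist_le_of_far {K : ℝ} {A : Set X} (hA : IsContractingSet K A)
    (hK : 0 < K) {γ : ℝ → X} {u v : ℝ} (huv : u ≤ v)
    (hγ : ∀ s ∈ Set.Icc u v, ∀ t ∈ Set.Icc u v, dist (γ s) (γ t) = |s - t|)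
    (hfar : ∀ t ∈ Set.Icc u v, 3 * K ≤ Metric.infDist (γ t) A)
    {p q : X} (hp : p ∈ closestPoints A (γ u)) (hq : q ∈ closestPoints A (γ v)) :
    dist p q ≤ K + (v - u) / 2 := by
  have key : ∀ n : ℕ, ∀ w ∈ Set.Icc u v, w - u ≤ 2 * K * (n + 1) →
      ∀ q ∈ closestPoints A (γ w), dist p q ≤ K * (n + 1) := by
    intro n
    induction n with
    | zero =>
      intro w hw hle q hq
      have := hA.dist_le hK hp hq (by
        rw [hγ u ⟨le_rfl, huv⟩ w hw, abs_sub_comm, abs_of_nonneg (by linarith [hw.1])]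
        have := hfar u ⟨le_rfl, huv⟩
        push_cast at hle
        linarith)
      simpa using this
    | succ n ih =>
      intro w hw hle q hq
      have hw' : max u (w - 2 * K) ∈ Set.Icc u v :=
        ⟨le_max_left _ _, max_le huv (by linarith [hw.2])⟩
      obtain ⟨q', hq'⟩ := hA.1 (γ (max u (w - 2 * K)))
      have h1 := ih _ hw' (by
        push_cast at hle
        rcases max_cases u (w - 2 * K) with h | h <;> rw [h.1]
        · have : (0 : ℝ) ≤ n := n.cast_nonneg
          nlinarith
        · linarith) q' hq'
      have h2 := hA.dist_le hK hq' hq (by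
        rw [hγ _ hw' w hw, abs_sub_comm, abs_of_nonneg (by
          have := max_le hw.1 (by linarith : w - 2 * K ≤ w); linarith)]
        have := hfar _ hw'
        have := le_max_right u (w - 2 * K)
        linarith)
      have := dist_triangle p q' q
      push_cast
      linarith
  have h := key ⌊(v - u) / (2 * K)⌋₊ v ⟨huv, le_rfl⟩ (by
    have := (Nat.lt_floor_add_one ((v - u) / (2 * K))).le
    rwa [div_le_iff₀ (by positivity), mul_comm] at this) q hq
  have h2 := Nat.floor_le (div_nonneg (by linarith) (by positivity) : 0 ≤ (v - u) / (2 * K))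
  have h3 : K * ((v - u) / (2 * K)) = (v - u) / 2 := by field_simp
  nlinarith

/-- If `x` and `y` have distant projections to a contracting set, then a geodesic from `x` to `y`
passes near the projection of `x`. -/
theorem IsContractingSet.exists_between {K : ℝ} {A : Set X} (hX : IsGeodesicSpace X)
    (hA : IsContractingSet K A) (hK : 0 < K) {x y p q : X} (hp : p ∈ closestPoints A x)
    (hq : q ∈ closestPoints A y) (hpq : 8 * K < dist p q) :
    ∃ z, dist x z + dist z y = dist x y ∧ dist z p ≤ 12 * K := by
  obtain ⟨γ, h0, hL, hγ⟩ := hX x y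
  set L := dist x y with hLdef
  have hL0 : 0 ≤ L := dist_nonneg
  have m0 : (0 : ℝ) ∈ Set.Icc 0 L := ⟨le_rfl, hL0⟩
  have mL : L ∈ Set.Icc 0 L := ⟨hL0, le_rfl⟩
  have hdx : ∀ t ∈ Set.Icc 0 L, dist x (γ t) = t := by
    intro t ht
    rw [← h0, hγ 0 m0 t ht, zero_sub, abs_neg, abs_of_nonneg ht.1]
  have hdy : ∀ t ∈ Set.Icc 0 L, dist (γ t) y = L - t := by
    intro t ht
    rw [← hL, hγ t ht L mL, abs_sub_comm, abs_of_nonneg (by linarith [ht.2])]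
  have hcont : ContinuousOn (fun t => Metric.infDist (γ t) A) (Set.Icc 0 L) := by
    refine (Metric.continuous_infDist_pt A).comp_continuousOn ?_
    refine LipschitzOnWith.continuousOn (K := 1) ?_
    refine LipschitzOnWith.of_dist_le_mul fun s hs t ht => ?_
    rw [hγ s hs t ht, Real.dist_eq]; simp
  set S := {t ∈ Set.Icc 0 L | Metric.infDist (γ t) A ≤ 3 * K} with hS
  have hScomp : IsCompact S := by
    have : S = Set.Icc 0 L ∩ (fun t => Metric.infDist (γ t) A) ⁻¹' Set.Iic (3 * K) := by
      ext t; simp [hS]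
    rw [this]
    exact isCompact_Icc.of_isClosed_subset
      (hcont.preimage_isClosed_of_isClosed isClosed_Icc isClosed_Iic) Set.inter_subset_left
  have hpx : dist x p = Metric.infDist x A := hp.2
  have hqy : dist y q = Metric.infDist y A := hq.2
  rcases S.eq_empty_or_nonempty with hemp | hne
  · -- A geodesic that avoids the `3K`-neighbourhood of `A` has close projections.
    exfalso
    have hfar : ∀ t ∈ Set.Icc 0 L, 3 * K < Metric.infDist (γ t) A := by
      intro t ht
      by_contra hcon
      have : t ∈ S := ⟨ht, not_lt.1 hcon⟩
      rw [hemp] at this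
      exact this
    have ha := hfar 0 m0
    have hb := hfar L mL
    rw [h0] at ha
    rw [hL] at hb
    set a := Metric.infDist x A
    set b := Metric.infDist y A
    by_cases hcase : L - (b - K) ≤ a - K
    · have hm : min (a - K) L ∈ Set.Icc 0 L := ⟨le_min (by linarith) hL0, min_le_right _ _⟩
      obtain ⟨r, hr⟩ := hA.1 (γ (min (a - K) L))
      have h1 := hA.dist_le hK hp hr (by rw [hdx _ hm]; exact min_le_left _ _)
      have h2 := hA.dist_le hK hq hr (by
        rw [dist_comm, hdy _ hm]
        rcases min_cases (a - K) L with h | h <;> rw [h.1] <;> linarith)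
      have := dist_triangle_right p q r
      linarith
    · have m1 : a - K ∈ Set.Icc 0 L := ⟨by linarith, by linarith⟩
      have m2 : L - (b - K) ∈ Set.Icc 0 L := ⟨by linarith, by linarith⟩
      obtain ⟨r, hr⟩ := hA.1 (γ (a - K))
      obtain ⟨r', hr'⟩ := hA.1 (γ (L - (b - K)))
      have h1 := hA.dist_le hK hp hr (by rw [hdx _ m1])
      have h2 := hA.dist_le hK hq hr' (by rw [dist_comm, hdy _ m2]; linarith)
      have h3 := hA.dist_le_of_far hK (u := a - K) (v := L - (b - K)) (by linarith)
        (fun s hs t ht => hγ s ⟨by linarith [hs.1], by linarith [hs.2]⟩ t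
          ⟨by linarith [ht.1], by linarith [ht.2]⟩)
        (fun t ht => (hfar t ⟨by linarith [ht.1], by linarith [ht.2]⟩).le) hr hr'
      have t1 := dist_triangle4 p r r' q
      have t2 := dist_triangle4 x p q y
      rw [dist_comm r' q] at t1
      rw [dist_comm q y] at t2
      linarith
  · -- Otherwise take the first point of the geodesic in the `3K`-neighbourhood.
    obtain ⟨t₀, ht₀, hmin⟩ := hScomp.exists_isLeast hne
    have hz := hdx t₀ ht₀.1
    refine ⟨γ t₀, by rw [hz, hdy t₀ ht₀.1]; ring, ?_⟩
    rcases ht₀.1.1.eq_or_lt with h00 | hpos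
    · rw [← h00, h0, hpx]
      have := ht₀.2
      rw [← h00, h0] at this
      linarith
    have hlt : ∀ t ∈ Set.Ico 0 t₀, 3 * K < Metric.infDist (γ t) A := by
      intro t ht
      by_contra hcon
      exact absurd (hmin ⟨⟨ht.1, ht.2.le.trans ht₀.1.2⟩, not_lt.1 hcon⟩) (not_le.2 ht.2)
    have hge : ∀ t ∈ Set.Icc 0 t₀, 3 * K ≤ Metric.infDist (γ t) A := by
      have hcl : closure (Set.Ico 0 t₀) = Set.Icc 0 t₀ := closure_Ico hpos.ne
      have hc' : ContinuousOn (fun t => Metric.infDist (γ t) A) (closure (Set.Ico 0 t₀)) := by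
        rw [hcl]; exact hcont.mono (Set.Icc_subset_Icc_right ht₀.1.2)
      intro t ht
      rw [← hcl] at ht
      exact le_on_closure (fun t ht => (hlt t ht).le) continuousOn_const hc' ht
    have ha := hlt 0 ⟨le_rfl, hpos⟩
    rw [h0] at ha
    set a := Metric.infDist x A
    obtain ⟨r, hr⟩ := hA.1 (γ t₀)
    have hzr : dist (γ t₀) r ≤ 3 * K := hr.2.trans_le ht₀.2
    by_cases hcase : t₀ ≤ a - K
    · have h1 := hA.dist_le hK hp hr (by rw [hz]; exact hcase)
      have := dist_triangle_right (γ t₀) p r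
      linarith
    · have m1 : a - K ∈ Set.Icc 0 L := ⟨by linarith, by linarith [ht₀.1.2]⟩
      obtain ⟨r', hr'⟩ := hA.1 (γ (a - K))
      have h1 := hA.dist_le hK hp hr' (by rw [hdx _ m1])
      have h3 := hA.dist_le_of_far hK (u := a - K) (v := t₀) (by linarith)
        (fun s hs t ht => hγ s ⟨by linarith [hs.1], by linarith [hs.2, ht₀.1.2]⟩ t
          ⟨by linarith [ht.1], by linarith [ht.2, ht₀.1.2]⟩)
        (fun t ht => hge t ⟨by linarith [ht.1], ht.2⟩) hr' hr
      have t1 := dist_triangle p r' r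
      have t2 := dist_triangle4 x p r (γ t₀)
      have t3 := dist_triangle_right (γ t₀) p r
      rw [dist_comm r (γ t₀)] at t2
      linarith

/-- If `x` and `y` have distant projections, a path from `x` to `y` essentially passes through the
projection of `x`. -/
theorem IsContractingSet.dist_add_dist_le {K : ℝ} {A : Set X} (hX : IsGeodesicSpace X)
    (hA : IsContractingSet K A) (hK : 0 < K) {x y p q : X} (hp : p ∈ closestPoints A x)
    (hq : q ∈ closestPoints A y) (hpq : 8 * K < dist p q) :
    dist x p + dist p y ≤ dist x y + 24 * K := by
  obtain ⟨z, hz, hzp⟩ := hA.exists_between hX hK hp hq hpq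
  have h1 := dist_triangle x z p
  have h2 := dist_triangle_left p y z
  linarith

/-- The projection of `x` is essentially on the way from `x` to any point of the set. -/
theorem IsContractingSet.dist_add_dist_le_of_mem {K : ℝ} {A : Set X} (hX : IsGeodesicSpace X)
    (hA : IsContractingSet K A) (hK : 0 < K) {x e w : X} (he : e ∈ closestPoints A x)
    (hw : w ∈ A) : dist x e + dist e w ≤ dist x w + 24 * K := by
  by_cases h : 8 * K < dist e w
  · exact hA.dist_add_dist_le hX hK he (mem_closestPoints_self hw) h
  · linarith [dist_le_of_mem_closestPoints he hw]

/-- Projections to contracting sets are coarsely Lipschitz. -/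
theorem IsContractingSet.dist_projection_le {K : ℝ} {A : Set X} (hX : IsGeodesicSpace X)
    (hA : IsContractingSet K A) (hK : 0 < K) {x y p q : X} (hp : p ∈ closestPoints A x)
    (hq : q ∈ closestPoints A y) : dist p q ≤ dist x y + 48 * K := by
  by_cases h : 8 * K < dist p q
  · have h1 := hA.dist_add_dist_le hX hK hp hq h
    have h2 := hA.dist_add_dist_le_of_mem hX hK hq hp.1
    rw [dist_comm y p, dist_comm q p] at h2
    have := dist_nonneg (x := x) (y := p)
    have := dist_nonneg (x := y) (y := q)
    linarith
  · linarith [dist_nonneg (x := x) (y := y)]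

/-- Geodesics between points of a contracting set stay close to it. -/
theorem IsContractingSet.dist_le_of_between {K : ℝ} {A : Set X} (hX : IsGeodesicSpace X)
    (hA : IsContractingSet K A) (hK : 0 < K) {x y z e : X} (hx : x ∈ A) (hy : y ∈ A)
    (hz : dist x z + dist z y = dist x y) (he : e ∈ closestPoints A z) : dist z e ≤ 24 * K := by
  have h1 := hA.dist_add_dist_le_of_mem hX hK he hx
  have h2 := hA.dist_add_dist_le_of_mem hX hK he hy
  have h3 := dist_triangle_left x y e
  rw [dist_comm z x] at h1
  linarith

/-- Behrstock's inequality: of the projections of a point `x` to two contracting sets, at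
least one is close to the projection of the other set. -/
theorem IsContractingSet.behrstock {K : ℝ} {A B : Set X} (hX : IsGeodesicSpace X)
    (hA : IsContractingSet K A) (hB : IsContractingSet K B) (hK : 0 < K) {x p b q r : X}
    (hp : p ∈ closestPoints A x) (hb : b ∈ closestPoints B x) (hq : q ∈ closestPoints A b)
    (hpq : 8 * K < dist p q) (hr : r ∈ closestPoints B p) : dist b r ≤ 60 * K := by
  obtain ⟨z, hz, hzp⟩ := hA.exists_between hX hK hp hq hpq
  have := hB.dist_projection_le hX hK (mem_closestPoints_of_between hb hz) hr
  linarith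

end ContractingSets
end ContractingWalk

/-! ### Gates along a path -/

namespace ContractingWalk

section Gates

variable {X : Type*} [MetricSpace X]

/-- All closest points of `x` in `α` are within `D` of `c`. -/
def ProjNear (D : ℝ) (α : Set X) (c x : X) : Prop :=
  ∀ p ∈ closestPoints α x, dist p c ≤ D

/-- A gate of width `ℓ`: two points at distance `ℓ` on a contracting set `α`. -/
structure IsGate (K ℓ : ℝ) (α : Set X) (c c' : X) : Prop where
  contracting : IsContractingSet K α
  left_mem : c ∈ α
  right_mem : c' ∈ α
  dist_eq : dist c c' = ℓ

theorem IsGate.symm {K ℓ : ℝ} {α : Set X} {c c' : X} (h : IsGate K ℓ α c c') :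
    IsGate K ℓ α c' c :=
  ⟨h.contracting, h.right_mem, h.left_mem, by rw [dist_comm, h.dist_eq]⟩

/-- The gate `(c, c')` separates `x₁, x₂` from `y₁, y₂`: the former project near `c` and the latter
near `c'`. Two points on each side are what the two-sided argument uses. -/
structure Separates (K D ℓ : ℝ) (α : Set X) (c c' x₁ x₂ y₁ y₂ : X) : Prop where
  gate : IsGate K ℓ α c c'
  x₁_near : ProjNear D α c x₁
  x₂_near : ProjNear D α c x₂
  y₁_near : ProjNear D α c' y₁
  y₂_near : ProjNear D α c' y₂

theorem Separates.symm {K D ℓ : ℝ} {α : Set X} {c c' x₁ x₂ y₁ y₂ : X}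
    (h : Separates K D ℓ α c c' x₁ x₂ y₁ y₂) : Separates K D ℓ α c' c y₁ y₂ x₁ x₂ :=
  ⟨h.gate.symm, h.y₁_near, h.y₂_near, h.x₁_near, h.x₂_near⟩

/-- If `c'` is essentially on the way from `c` to `y`, and `x` projects near `c`, then `c` is
essentially on the way from `x` to `y`. The error does not depend on the error `M` in the
hypothesis, which is why errors do not accumulate along a chain of gates. -/
theorem IsGate.dist_add_dist_le {K ℓ E M : ℝ} {α : Set X} {c c' x y : X}
    (hX : IsGeodesicSpace X) (hK : 0 < K) (h : IsGate K ℓ α c c') (hx : ProjNear E α c x)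
    (hy : ℓ + dist c' y ≤ dist c y + M) (hℓ : M / 2 + E + 20 * K < ℓ) :
    dist x c + dist c y ≤ dist x y + (2 * E + 24 * K) := by
  obtain ⟨p, hp⟩ := h.contracting.1 x
  obtain ⟨q, hq⟩ := h.contracting.1 y
  have hpc := hx p hp
  have hpq : 8 * K < dist p q := by
    by_contra hcon
    have h1 := h.contracting.dist_add_dist_le_of_mem hX hK hq h.right_mem
    have h2 := dist_triangle_left c q p
    have h3 := dist_triangle c q y
    have h4 := dist_triangle c q c'
    rw [dist_comm q y] at h3
    rw [h.dist_eq] at h4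
    rw [dist_comm y c'] at h1
    linarith
  have h1 := h.contracting.dist_add_dist_le hX hK hp hq hpq
  have h2 := dist_triangle x p c
  have h3 := dist_triangle_left c y p
  linarith

/-- If `y` projects near `c'`, then `c'` is essentially on the way from `c` to `y`. -/
theorem IsGate.add_dist_le {K ℓ D : ℝ} {α : Set X} {c c' y : X}
    (hX : IsGeodesicSpace X) (hK : 0 < K) (h : IsGate K ℓ α c c') (hy : ProjNear D α c' y) :
    ℓ + dist c' y ≤ dist c y + (2 * D + 24 * K) := by
  obtain ⟨q, hq⟩ := h.contracting.1 y
  have hqc := hy q hq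
  have h1 := h.contracting.dist_add_dist_le_of_mem hX hK hq h.left_mem
  have h2 := dist_triangle c' q y
  have h3 := dist_triangle c q c'
  rw [h.dist_eq] at h3
  rw [dist_comm q y, dist_comm c' q] at h2
  rw [dist_comm q c, dist_comm y c] at h1
  linarith

/-- A path from a point projecting near `c` to one projecting near `c'` essentially passes
through `c` and then `c'`. -/
theorem IsGate.dist_add_add_dist_le {K ℓ D : ℝ} {α : Set X} {c c' x y : X}
    (hX : IsGeodesicSpace X) (hK : 0 < K) (hD : 0 ≤ D) (hℓ : 200 * (D + K) < ℓ)
    (h : IsGate K ℓ α c c') (hx : ProjNear D α c x) (hy : ProjNear D α c' y) :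
    dist x c + ℓ + dist c' y ≤ dist x y + (4 * D + 48 * K) := by
  have h1 := h.add_dist_le hX hK hy
  have h2 := h.dist_add_dist_le hX hK hx h1 (by linarith)
  linarith

/-- At every scale `r ≥ k` and for every single time `t` comparable to `r`, some gate located on
the path `Q` between the times `r * M` and `2 * r * M` separates `x₁, x₂` from `Q t`. -/
def ScaleSeparated (K D ℓ : ℝ) (M k : ℕ) (Q : ℕ → X) (x₁ x₂ : X) : Prop :=
  ∀ r, k ≤ r → ∀ t, 2 * r * M ≤ t → t ≤ 8 * r * M →
    ∃ α : Set X, ∃ i i', r * M ≤ i ∧ i ≤ 2 * r * M ∧ i' ≤ 2 * r * M ∧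
      Separates K D ℓ α (Q i) (Q i') x₁ x₂ (Q (2 * r * M)) (Q t)

/-- Chaining gates over dyadic scales: if `Q` is separated from `x₁, x₂` at each scale, for times
comparable to the scale, then it is so for all later times. -/
theorem ScaleSeparated.exists_separates {K D ℓ : ℝ} (hX : IsGeodesicSpace X) (hK : 0 < K)
    (hD : 0 ≤ D) (hℓ : 200 * (D + K) < ℓ) {Q : ℕ → X} {M k : ℕ} (hM : 0 < M) (hk : 0 < k)
    {x₁ x₂ : X} (H : ScaleSeparated K D ℓ M k Q x₁ x₂) (n r : ℕ) (hr : k ≤ r)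
    (hn : 2 * r * M ≤ n) :
    ∃ α : Set X, ∃ i i', r * M ≤ i ∧ i ≤ 2 * r * M ∧ i' ≤ 2 * r * M ∧
      Separates K D ℓ α (Q i) (Q i') x₁ x₂ (Q (2 * r * M)) (Q (2 * r * M)) ∧
      ℓ + dist (Q i') (Q n) ≤ dist (Q i) (Q n) + (6 * D + 72 * K) := by
  induction h : n - r using Nat.strong_induction_on generalizing r with
  | _ d ih =>
    by_cases hcase : n ≤ 8 * r * M
    · obtain ⟨α, i, i', h1, h2, h3, hs⟩ := H r hr n hn hcase
      refine ⟨α, i, i', h1, h2, h3, ⟨hs.gate, hs.x₁_near, hs.x₂_near, hs.y₁_near, hs.y₁_near⟩, ?_⟩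
      linarith [hs.gate.add_dist_le hX hK hs.y₂_near]
    · -- The gate at scale `2r` is passed on the way to `Q n`, and the gate at scale `r` is passed
      -- on the way to the former.
      have hnr : r < n := by nlinarith
      obtain ⟨β, j, j', h1, h2, h3, hβ, hy⟩ :=
        ih (n - 2 * r) (by omega) (2 * r) (by omega) (by nlinarith) rfl
      have e1 := hβ.gate.dist_add_dist_le hX hK hβ.x₁_near hy (by linarith)
      obtain ⟨α, i, i', g1, g2, g3, hs⟩ := H r hr j h1 (by nlinarith)
      refine ⟨α, i, i', g1, g2, g3, ⟨hs.gate, hs.x₁_near, hs.x₂_near, hs.y₁_near, hs.y₁_near⟩, ?_⟩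
      have e2 := hs.gate.dist_add_add_dist_le hX hK hD hℓ hs.x₁_near hs.y₂_near
      have e3 := dist_triangle x₁ (Q i) (Q n)
      have e4 := dist_triangle (Q i') (Q j) (Q n)
      linarith

theorem ScaleSeparated.exists_dist_add_dist_le {K D ℓ : ℝ} (hX : IsGeodesicSpace X) (hK : 0 < K)
    (hD : 0 ≤ D) (hℓ : 200 * (D + K) < ℓ) {Q : ℕ → X} {M k : ℕ} (hM : 0 < M) (hk : 0 < k)
    {x : X} (H : ScaleSeparated K D ℓ M k Q x x) (n : ℕ) :
    ∃ i ≤ 2 * k * M, dist x (Q i) + dist (Q i) (Q n) ≤ dist x (Q n) + (2 * D + 40 * K) := by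
  by_cases hn : n ≤ 2 * k * M
  · exact ⟨n, hn, by rw [dist_self]; linarith⟩
  · obtain ⟨α, i, i', -, h2, -, hs, hy⟩ :=
      H.exists_separates hX hK hD hℓ hM hk n k le_rfl (not_le.1 hn).le
    refine ⟨i, h2, ?_⟩
    linarith [hs.gate.dist_add_dist_le hX hK hs.x₁_near hy (by linarith)]

/-- Two paths `Q` and `Q'` that are separated from each other at each scale diverge: a path from
any `Q' n'` to any `Q n` essentially passes through one of the first points of `Q`. -/
theorem exists_dist_add_dist_le_of_scaleSeparated {K D ℓ : ℝ} (hX : IsGeodesicSpace X)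
    (hK : 0 < K) (hD : 0 ≤ D) (hℓ : 200 * (D + K) < ℓ) {Q Q' : ℕ → X} {M k : ℕ} (hM : 0 < M)
    (hk : 0 < k)
    (H : ∀ m₁ ≤ 2 * k * M, ∀ m₂ ≤ 2 * k * M, ScaleSeparated K D ℓ M k Q (Q' m₁) (Q' m₂))
    (H' : ∀ m₁ ≤ 2 * k * M, ∀ m₂ ≤ 2 * k * M, ScaleSeparated K D ℓ M k Q' (Q m₁) (Q m₂))
    (n n' : ℕ) :
    ∃ i ≤ 2 * k * M,
      dist (Q' n') (Q i) + dist (Q i) (Q n) ≤ dist (Q' n') (Q n) + (2 * D + 40 * K) := by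
  by_cases hn' : n' ≤ 2 * k * M
  · exact (H n' hn' n' hn').exists_dist_add_dist_le hX hK hD hℓ hM hk n
  by_cases hn : n ≤ 2 * k * M
  · exact ⟨n, hn, by rw [dist_self]; linarith⟩
  -- A gate `β` of `Q'` separates `Q' n'` from the reference point `z` of `Q`, and a gate `α`
  -- of `Q` separates both ends of `β` from `z` and from `Q n`.
  set u := Q' n'
  set y := Q n
  obtain ⟨β, j, j', -, hj, hj', hβ, hu⟩ := (H' _ le_rfl _ le_rfl).exists_separates hX hK hD hℓ hM
    hk n' k le_rfl (not_le.1 hn').le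
  obtain ⟨α, i, i', -, hi, hi', hα, hy⟩ := (H j hj j' hj').exists_separates hX hK hD hℓ hM hk n k
    le_rfl (not_le.1 hn).le
  refine ⟨i, hi, ?_⟩
  set z := Q (2 * k * M)
  set b := Q' j
  set b' := Q' j'
  set c := Q i
  set c' := Q i'
  have hu : ℓ + dist b' u ≤ dist b u + (6 * D + 72 * K) := hu
  have e1 : dist z b + dist b u ≤ dist z u + (2 * D + 24 * K) :=
    hβ.gate.dist_add_dist_le hX hK hβ.x₁_near hu (by linarith)
  have e2 := hα.gate.dist_add_add_dist_le hX hK hD hℓ hα.x₁_near hα.y₁_near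
  have hunear : ProjNear (D + 8 * K) α c u := by
    intro e he
    by_contra hcon
    obtain ⟨p, hp⟩ := hα.gate.contracting.1 b'
    have hpc := hα.x₂_near p hp
    -- Otherwise a path from `u` to `b'` passes near `c`, so that it traverses `β` twice.
    have e3 := hα.gate.contracting.dist_add_dist_le hX hK hp he (by
      have := dist_triangle e p c
      rw [dist_comm e p] at this
      linarith)
    have t1 := dist_triangle_left c u p
    have t2 := dist_triangle b' p c
    have t3 := dist_triangle4 u c c' z
    rw [hα.gate.dist_eq] at t3
    rw [dist_comm c u] at t1
    rw [dist_comm z u, dist_comm z b] at e1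
    rw [dist_comm b' u] at e3 hu
    have t7 := dist_nonneg (x := c) (y := b')
    have t8 := dist_nonneg (x := b) (y := c)
    rw [dist_comm b' c] at t2
    linarith
  linarith [hα.gate.dist_add_dist_le hX hK hunear hy (by linarith)]

end Gates
end ContractingWalk

/-! ### Axes of independent contracting isometries -/

namespace ContractingWalk

section Axes

open scoped Pointwise

section Orbits

variable {X G : Type*} [Group G] [MulAction G X]

/-- The orbit of `o` under the powers of `a`. -/
def axis (o : X) (a : G) : Set X := Set.range fun n : ℤ => a ^ n • o

theorem zpow_smul_mem_axis (o : X) (a : G) (n : ℤ) : a ^ n • o ∈ axis o a := ⟨n, rfl⟩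

theorem mem_axis_self (o : X) (a : G) : o ∈ axis o a := ⟨0, by simp⟩

theorem zpow_smul_axis (o : X) (a : G) (n : ℤ) : a ^ n • axis o a = axis o a := by
  ext x
  rw [Set.mem_smul_set_iff_inv_smul_mem]
  constructor
  · rintro ⟨m, hm⟩
    exact ⟨n + m, by
      simp only at hm ⊢
      rw [zpow_add, mul_smul, hm, smul_inv_smul]⟩
  · rintro ⟨m, rfl⟩
    exact ⟨-n + m, by simp only [zpow_add, zpow_neg, mul_smul]⟩

end Orbits

section Projections

variable {X G : Type*} [MetricSpace X] [Group G] [MulAction G X]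

theorem IsContractingAxis.mono {K K' : ℝ} {γ : ℤ → X} (h : IsContractingAxis K γ)
    (hK : 0 < K) (hKK : K ≤ K') : IsContractingAxis K' γ := by
  refine ⟨fun m n => ⟨?_, ?_⟩, h.2.mono hKK⟩
  · have h1 := (h.1 m n).1
    have : |(m : ℝ) - n| / K' ≤ |(m : ℝ) - n| / K :=
      div_le_div_of_nonneg_left (abs_nonneg _) hK hKK
    linarith
  · have h1 := (h.1 m n).2
    have : K * |(m : ℝ) - n| ≤ K' * |(m : ℝ) - n| :=
      mul_le_mul_of_nonneg_right hKK (abs_nonneg _)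
    linarith

/-- If `a ^ i • o` and `b ^ j • o` can only be close for `j` in a bounded range, then the axis of
`a` has bounded projection to the axis of `b`. -/
theorem exists_projNear_axis {K : ℝ} (hX : IsGeodesicSpace X) (hK : 0 < K) {o : X} {a b : G}
    (ha : IsContractingAxis K fun n : ℤ => a ^ n • o)
    (hb : IsContractingAxis K fun n : ℤ => b ^ n • o)
    (hab : ∃ R : ℝ, ∀ i j : ℤ, dist (a ^ i • o) (b ^ j • o) < 37 * K → |(j : ℝ)| ≤ R) :
    ∃ D, 0 ≤ D ∧ ∀ n : ℤ, ProjNear D (axis o b) o (a ^ n • o) := by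
  obtain ⟨R, hR⟩ := hab
  refine ⟨max (8 * K) (K * R + K), le_max_of_le_left (by positivity), fun n q hq => ?_⟩
  by_cases hcase : dist q o ≤ 8 * K
  · exact le_max_of_le_left hcase
  obtain ⟨z, hz, hzq⟩ := hb.2.exists_between hX hK hq
    (mem_closestPoints_self (mem_axis_self o b)) (not_le.1 hcase)
  obtain ⟨e, he⟩ := ha.2.1 z
  have h1 := ha.2.dist_le_of_between hX hK (zpow_smul_mem_axis o a n) (mem_axis_self o a) hz he
  obtain ⟨i, rfl⟩ := he.1
  obtain ⟨j, rfl⟩ := hq.1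
  have h2 := dist_triangle_left (a ^ i • o) (b ^ j • o) z
  have h3 := hR i j (by simp only at h1 hzq; linarith)
  have h4 := (hb.1 j 0).2
  simp only [zpow_zero, one_smul, Int.cast_zero, sub_zero] at h4 ⊢
  refine le_max_of_le_right (h4.trans ?_)
  nlinarith

end Projections

variable {X G : Type*} [MetricSpace X] [Group G] [MulAction G X] [IsIsometricSMul G X]

theorem smul_mem_closestPoints_iff {A : Set X} {x p : X} (g : G) :
    g • p ∈ closestPoints (g • A) (g • x) ↔ p ∈ closestPoints A x := by
  have h : Metric.infDist (g • x) (g • A) = Metric.infDist x A :=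
    Metric.infDist_image (isometry_smul X g)
  simp only [closestPoints, Set.mem_ofPred_eq, Set.smul_mem_smul_set_iff, dist_smul, h]

theorem closestPoints_smul (A : Set X) (x : X) (g : G) :
    closestPoints (g • A) (g • x) = g • closestPoints A x := by
  ext p
  rw [Set.mem_smul_set_iff_inv_smul_mem, ← smul_mem_closestPoints_iff (p := g⁻¹ • p) g,
    smul_inv_smul]

theorem IsContractingSet.smul {K : ℝ} {A : Set X} (hA : IsContractingSet K A) (g : G) :
    IsContractingSet K (g • A) := by
  have h : ∀ z : X, closestPoints (g • A) z = g • closestPoints A (g⁻¹ • z) := fun z => by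
    rw [← closestPoints_smul, smul_inv_smul]
  refine ⟨fun z => ?_, fun x y hxy => ?_⟩
  · rw [h]
    exact (hA.1 _).smul_set
  · rw [h, h, ← Set.smul_set_union]
    have e : Metric.infDist x (g • A) = Metric.infDist (g⁻¹ • x) A := by
      conv_lhs => rw [← smul_inv_smul g x]
      exact Metric.infDist_image (isometry_smul X g)
    exact ((isometry_smul X g).ediam_image _).trans_le
      (hA.2 _ _ (by rw [dist_smul, ← e]; exact hxy))

theorem projNear_smul_iff {D : ℝ} {A : Set X} {c x : X} (g : G) :
    ProjNear D (g • A) (g • c) (g • x) ↔ ProjNear D A c x := by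
  unfold ProjNear
  rw [closestPoints_smul]
  constructor
  · intro h p hp
    have := h (g • p) (Set.smul_mem_smul_set hp)
    rwa [dist_smul] at this
  · rintro h _ ⟨p, hp, rfl⟩
    simpa only [dist_smul] using h p hp

/-- For independent contracting isometries `a, b`, sufficiently spaced translates of the axis
of `a` along the axis of `b` have bounded projections to each other, so that a point has a
non-trivial projection to at most one of them. -/
theorem exists_spaced_axes {K : ℝ} (hX : IsGeodesicSpace X) (hK : 0 < K) {o : X} {a b : G}
    (ha : IsContractingAxis K fun n : ℤ => a ^ n • o)
    (hb : IsContractingAxis K fun n : ℤ => b ^ n • o)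
    (hab : IndependentIsometries o a b) :
    ∃ (s : ℕ) (D : ℝ), 0 ≤ D ∧ (∀ n : ℤ, ProjNear D (axis o a) o (b ^ n • o)) ∧
      ∀ (x : X) (l l' : ℤ),
        ¬ ProjNear D (b ^ (l * s) • axis o a) (b ^ (l * s) • o) x →
        ¬ ProjNear D (b ^ (l' * s) • axis o a) (b ^ (l' * s) • o) x → l = l' := by
  obtain ⟨R, hR⟩ := isBounded_iff_forall_norm_le.1 (hab (37 * K) (by positivity))
  have hR' : ∀ i j : ℤ, dist (a ^ i • o) (b ^ j • o) < 37 * K → |(i : ℝ)| ≤ R ∧ |(j : ℝ)| ≤ R := by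
    intro i j h
    have := hR (i, j) h
    rw [Prod.norm_def, max_le_iff] at this
    simpa [Int.norm_eq_abs] using this
  obtain ⟨D₁, h₁, hproj₁⟩ := exists_projNear_axis hX hK ha hb ⟨R, fun i j h => (hR' i j h).2⟩
  obtain ⟨D₂, h₂, hproj₂⟩ := exists_projNear_axis hX hK hb ha
    ⟨R, fun i j h => (hR' j i (by rwa [dist_comm])).1⟩
  obtain ⟨s, hs⟩ := exists_nat_gt (K * (2 * D₁ + 9 * K))
  have hspace : ∀ m : ℤ, m ≠ 0 → 2 * D₁ + 8 * K < dist (b ^ (m * s) • o) o := by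
    intro m hm
    have h := (hb.1 (m * s) 0).1
    simp only [zpow_zero, one_smul, Int.cast_zero, sub_zero, Int.cast_mul, Int.cast_natCast] at h
    have h1 : (1 : ℝ) ≤ |(m : ℝ)| := by exact_mod_cast Int.one_le_abs hm
    have h2 : (s : ℝ) ≤ |(m : ℝ) * s| := by
      rw [abs_mul, Nat.abs_cast]
      nlinarith [(Nat.cast_nonneg s : (0 : ℝ) ≤ s)]
    have h3 : 2 * D₁ + 9 * K < |(m : ℝ) * s| / K := by
      rw [lt_div_iff₀ hK, mul_comm]
      linarith
    linarith
  have hcA : IsContractingSet K (axis o a) := ha.2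
  have hcB : IsContractingSet K (axis o b) := hb.2
  have hcross : ∀ m : ℤ, m ≠ 0 → ∀ n : ℤ,
      ProjNear (D₂ + 60 * K) (axis o a) o (b ^ (m * s) • a ^ n • o) := by
    intro m hm n q hq
    obtain ⟨p, hp⟩ := hcB.1 (a ^ n • o)
    have hp1 := hproj₁ n p hp
    have hp2 : b ^ (m * s) • p ∈ closestPoints (axis o b) (b ^ (m * s) • a ^ n • o) := by
      rw [← zpow_smul_axis o b (m * s)]
      exact (smul_mem_closestPoints_iff _).2 hp
    obtain ⟨r, hr⟩ := hcB.1 q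
    obtain ⟨i, hi⟩ := hq.1
    have hr1 : dist r o ≤ D₁ := hproj₁ i r (by rw [← hi] at hr; exact hr)
    have hd := hspace m hm
    obtain ⟨t, ht⟩ := hcA.1 (b ^ (m * s) • p)
    obtain ⟨j, hj⟩ := hp2.1
    have ht1 : dist t o ≤ D₂ := hproj₂ j t (by rw [← hj] at ht; exact ht)
    have hq1 := hcB.behrstock hX hcA hK hp2 hq hr (by
      have := dist_triangle4 (b ^ (m * s) • o) (b ^ (m * s) • p) r o
      rw [dist_smul, dist_comm o p] at this
      linarith) ht
    linarith [dist_triangle q t o]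
  refine ⟨s, D₂ + 130 * K, by positivity, fun n p hp => (hproj₂ n p hp).trans (by linarith), ?_⟩
  intro x l l' hl hl'
  by_contra hne
  set m := l' - l with hm
  have hm0 : m ≠ 0 := sub_ne_zero.2 (Ne.symm hne)
  -- Translate so that the first axis is the axis of `a`.
  obtain ⟨x, rfl⟩ : ∃ x' : X, x = b ^ (l * s) • x' := ⟨_, (smul_inv_smul _ x).symm⟩
  have hl'm : b ^ (l' * s) = b ^ (l * s) * b ^ (m * s) := by
    rw [← zpow_add]; congr 1; rw [hm]; ring
  rw [projNear_smul_iff] at hl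
  rw [hl'm, mul_smul, mul_smul, projNear_smul_iff] at hl'
  unfold ProjNear at hl hl'
  push Not at hl hl'
  obtain ⟨p, hp, hpD⟩ := hl
  obtain ⟨p', hp', hpD'⟩ := hl'
  obtain ⟨q, hq⟩ := hcA.1 p'
  obtain ⟨_, ⟨n, rfl⟩, hn⟩ := hp'.1
  have hq1 : dist q o ≤ D₂ + 60 * K := hcross m hm0 n q (by
    simp only at hn; rw [hn]; exact hq)
  obtain ⟨r, hr⟩ := (hcA.smul (b ^ (m * s))).1 p
  obtain ⟨i, hi⟩ := hp.1
  have hr1 : dist r (b ^ (m * s) • o) ≤ D₂ + 60 * K := by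
    have h := hcross (-m) (neg_ne_zero.2 hm0) i ((b ^ (m * s))⁻¹ • r) (by
      have h2 := (smul_mem_closestPoints_iff (b ^ (m * s))⁻¹).2 hr
      rw [inv_smul_smul, ← hi, ← zpow_neg, ← neg_mul] at h2
      rw [← zpow_neg, ← neg_mul]
      exact h2)
    rwa [← dist_smul (b ^ (m * s)), smul_inv_smul] at h
  have hb1 := hcA.behrstock hX (hcA.smul (b ^ (m * s))) hK hp hp' hq (by
    have := dist_triangle p q o
    linarith) hr
  linarith [dist_triangle p' r (b ^ (m * s) • o)]

end Axes
end ContractingWalk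

/-! ### Schottky words -/

namespace ContractingWalk

section Schottky

section Words

variable {G : Type*}

/-- The word `b ^ i * a ^ n * b ^ k` spelled by means of words for `a` and `b`. -/
def gateWord (la lb : List G) (i n k : ℕ) : List G :=
  (List.replicate i lb).flatten ++ (List.replicate n la).flatten ++ (List.replicate k lb).flatten

theorem prod_map_gateWord {M : Type*} [CommMonoid M] (f : G → M) (la lb : List G) (i n k : ℕ) :
    ((gateWord la lb i n k).map f).prod =
      (lb.map f).prod ^ (i + k) * (la.map f).prod ^ n := by
  simp only [gateWord, List.map_append, List.map_flatten, List.map_replicate, List.prod_append,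
    List.prod_flatten, List.prod_replicate]
  rw [pow_add, mul_right_comm]

theorem length_gateWord (la lb : List G) (i n k : ℕ) :
    (gateWord la lb i n k).length = (i + k) * lb.length + n * la.length := by
  simp only [gateWord, List.length_append, List.length_flatten, List.map_replicate,
    List.sum_replicate, smul_eq_mul]
  ring

end Words

variable {X G : Type*} [MetricSpace X] [Group G] [MulAction G X]

/-- The product of the first `t` letters of a word. -/
def prefixProd (w : ℕ → G) (t : ℕ) : G := ((List.range t).map w).prod

/-- A family of fifty distinct words of the same length and of the same positive mass. Reading one
of them along the walk creates a gate (located at the times `entry j` and `exit j` of the word)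
which separates all the points of the past from all the points of the future, unless the word
is one of the few that are excluded by the given points: at most one word is excluded by each
point. Past points are seen from the beginning of the word and future ones from its end. The
width `ℓ` of the gates dominates the errors `D` and `K`. -/
structure SchottkySystem [MeasurableSpace G] (o : X) (μ : Measure G) (K D ℓ : ℝ) where
  K_pos : 0 < K
  D_nonneg : 0 ≤ D
  lt_ℓ : 200 * (D + K) < ℓ
  len : ℕ
  len_pos : 0 < len
  word : Fin 50 → ℕ → G
  mass : ℝ≥0∞
  mass_ne_zero : mass ≠ 0
  prod_eq_mass : ∀ j, ∏ t ∈ Finset.range len, μ {word j t} = mass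
  word_injective : ∀ j j', (∀ t < len, word j t = word j' t) → j = j'
  startOK : Fin 50 → X → Prop
  endOK : Fin 50 → X → Prop
  start_unique : ∀ x j j', ¬ startOK j x → ¬ startOK j' x → j = j'
  end_unique : ∀ y j j', ¬ endOK j y → ¬ endOK j' y → j = j'
  entry : Fin 50 → ℕ
  exit : Fin 50 → ℕ
  entry_le : ∀ j, entry j ≤ len
  exit_le : ∀ j, exit j ≤ len
  exists_separates : ∀ (j : Fin 50) (h : G) (x₁ x₂ y₁ y₂ : X),
    startOK j (h⁻¹ • x₁) → startOK j (h⁻¹ • x₂) →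
    endOK j ((h * prefixProd (word j) len)⁻¹ • y₁) →
    endOK j ((h * prefixProd (word j) len)⁻¹ • y₂) →
    ∃ α : Set X, Separates K D ℓ α ((h * prefixProd (word j) (entry j)) • o)
      ((h * prefixProd (word j) (exit j)) • o) x₁ x₂ y₁ y₂

theorem prefixProd_getD (L : List G) {t : ℕ} (ht : t ≤ L.length) :
    prefixProd (fun i => L.getD i 1) t = (L.take t).prod := by
  unfold prefixProd
  congr 1
  refine List.ext_getElem (by simp [ht]) fun i h1 h2 => ?_
  simp only [List.length_map, List.length_range] at h1
  simp [List.getElem?_eq_getElem (h1.trans_le ht)]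

theorem prod_range_getD {M : Type*} [CommMonoid M] (f : G → M) (L : List G) :
    ∏ t ∈ Finset.range L.length, f (L.getD t 1) = (L.map f).prod := by
  rw [Finset.prod_range, ← List.prod_ofFn]
  congr 1
  refine List.ext_getElem (by simp) fun i h1 h2 => ?_
  simp

theorem prod_flatten_replicate (l : List G) (n : ℕ) :
    (List.replicate n l).flatten.prod = l.prod ^ n := by
  simp [List.prod_flatten]

theorem prod_gateWord (la lb : List G) (i n k : ℕ) :
    (gateWord la lb i n k).prod = lb.prod ^ i * la.prod ^ n * lb.prod ^ k := by
  simp only [gateWord, List.prod_append, prod_flatten_replicate]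

open scoped Pointwise in
/-- A non-elementary measure admits a Schottky system: the words spell
`b ^ (j * s) * a ^ n * b ^ ((50 - j) * s)` for two independent contracting isometries `a` and
`b`, a large spacing `s`, and an even larger `n`. -/
theorem exists_schottkySystem [IsIsometricSMul G X] [MeasurableSpace G] (hX : IsGeodesicSpace X)
    {o : X} {μ : Measure G} (hμ : IsNonElementary o μ) :
    ∃ K D ℓ : ℝ, Nonempty (SchottkySystem o μ K D ℓ) := by
  obtain ⟨a, ha, b, hb, ⟨K₁, hK₁, hA⟩, ⟨K₂, hK₂, hB⟩, hab⟩ := hμ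
  obtain ⟨la, hla, rfl⟩ := Submonoid.exists_list_of_mem_closure ha
  obtain ⟨lb, hlb, rfl⟩ := Submonoid.exists_list_of_mem_closure hb
  set a := la.prod with hadef
  set b := lb.prod with hbdef
  set K := max K₁ K₂ with hKdef
  have hK : 0 < K := hK₁.trans_le (le_max_left _ _)
  replace hA := hA.mono hK₁ (le_max_left K₁ K₂)
  replace hB := hB.mono hK₂ (le_max_right K₁ K₂)
  rw [← hKdef] at hA hB
  obtain ⟨s, D, hD, hproj, huniq⟩ := exists_spaced_axes hX hK hA hB hab
  obtain ⟨n, hn⟩ := exists_nat_gt (K * (200 * (D + K) + K))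
  have hℓ : 200 * (D + K) < dist o (a ^ n • o) := by
    have h := (hA.1 0 n).1
    simp only [zpow_zero, one_smul, Int.cast_zero, Int.cast_natCast, zero_sub, abs_neg,
      Nat.abs_cast, zpow_natCast] at h
    have : 200 * (D + K) + K < (n : ℝ) / K := by
      rw [lt_div_iff₀ hK, mul_comm]; exact hn
    linarith
  have hlen : ∀ j : Fin 50, (gateWord la lb (j * s) n ((50 - j) * s)).length =
      50 * s * lb.length + n * la.length := by
    intro j
    rw [length_gateWord, ← add_mul, Nat.add_sub_cancel' j.2.le]
  have hle : ∀ j : Fin 50, j * s * lb.length ≤ 50 * s * lb.length := fun j =>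
    Nat.mul_le_mul_right _ (Nat.mul_le_mul_right _ j.2.le)
  have hinj : ∀ j j' : Fin 50, b ^ ((j : ℕ) * s) * a ^ n * b ^ ((50 - j : ℕ) * s) =
      b ^ ((j' : ℕ) * s) * a ^ n * b ^ ((50 - j' : ℕ) * s) → j = j' := by
    intro j j' h
    -- Both axes are excluded by the point `b ^ (j * s) * a ^ n * b ^ (-(j * s)) • o`.
    have hbad : ∀ i : Fin 50, ¬ ProjNear D (b ^ ((i : ℤ) * s) • axis o a) (b ^ ((i : ℤ) * s) • o)
        ((b ^ ((i : ℕ) * s) * a ^ n * b ^ ((50 - i : ℕ) * s) * (b ^ (50 * s))⁻¹) • o) := by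
      intro i hi
      have e : b ^ ((i : ℕ) * s) * a ^ n * b ^ ((50 - i : ℕ) * s) * (b ^ (50 * s))⁻¹ =
          b ^ ((i : ℤ) * s) * (a ^ (n : ℤ) * b ^ (-((i : ℤ) * s))) := by
        have h1 : b ^ (50 * s) = b ^ ((50 - i : ℕ) * s) * b ^ ((i : ℕ) * s) := by
          rw [← pow_add, ← add_mul, Nat.sub_add_cancel i.2.le]
        rw [h1, mul_inv_rev, zpow_neg]
        have h2 : b ^ ((i : ℤ) * s) = b ^ ((i : ℕ) * s) := by
          rw [← zpow_natCast]; push_cast; rfl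
        rw [h2, zpow_natCast]
        group
      rw [e, mul_smul, projNear_smul_iff] at hi
      obtain ⟨p, hp⟩ := hA.2.1 (b ^ (-((i : ℤ) * s)) • o)
      have hp1 := hproj _ p hp
      have hp2 : a ^ (n : ℤ) • p ∈ closestPoints (axis o a)
          ((a ^ (n : ℤ) * b ^ (-((i : ℤ) * s))) • o) := by
        rw [mul_smul, ← zpow_smul_axis o a n]
        exact (smul_mem_closestPoints_iff _).2 hp
      have h3 := hi _ hp2
      have h4 := dist_triangle_left o (a ^ n • o) (a ^ n • p)
      rw [dist_smul] at h4
      rw [zpow_natCast] at h3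
      linarith
    have := huniq _ j j' (hbad j) (by rw [h]; exact hbad j')
    exact Fin.ext (by exact_mod_cast this)
  have hM : 0 < 50 * s * lb.length + n * la.length := by
    by_contra hcon
    have h0 : ∀ j : Fin 50, gateWord la lb (j * s) n ((50 - j) * s) = [] := fun j =>
      List.eq_nil_of_length_eq_zero (by rw [hlen j]; omega)
    have := hinj 0 1 (by rw [hadef, hbdef, ← prod_gateWord, ← prod_gateWord, h0, h0])
    simp at this
  set ε := (lb.map fun g => μ {g}).prod ^ (50 * s) * (la.map fun g => μ {g}).prod ^ n with hε
  refine ⟨K, D, dist o (a ^ n • o), ⟨{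
    K_pos := hK
    D_nonneg := hD
    lt_ℓ := hℓ
    len := 50 * s * lb.length + n * la.length
    len_pos := hM
    word := fun j t => (gateWord la lb (j * s) n ((50 - j) * s)).getD t 1
    mass := ε
    mass_ne_zero := ?_
    prod_eq_mass := ?_
    word_injective := ?_
    startOK := fun j x => ProjNear D (b ^ ((j : ℤ) * s) • axis o a) (b ^ ((j : ℤ) * s) • o) x
    endOK := fun j y =>
      ProjNear D (b ^ (((j : ℤ) - 50) * s) • axis o a) (b ^ (((j : ℤ) - 50) * s) • o) y
    start_unique := fun x j j' h h' => Fin.ext (by exact_mod_cast huniq x j j' h h')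
    end_unique := fun y j j' h h' => Fin.ext (by
      have := huniq y _ _ h h'
      have : (j : ℤ) = j' := by linarith
      exact_mod_cast this)
    entry := fun j => j * s * lb.length
    exit := fun j => j * s * lb.length + n * la.length
    entry_le := fun j => (hle j).trans (Nat.le_add_right _ _)
    exit_le := fun j => Nat.add_le_add_right (hle j) _
    exists_separates := ?_ }⟩⟩
  · refine mul_ne_zero (pow_ne_zero _ ?_) (pow_ne_zero _ ?_) <;>
    · rw [Ne, List.prod_eq_zero_iff, List.mem_map]
      rintro ⟨g, hg, h0⟩
      first | exact hlb g hg h0 | exact hla g hg h0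
  · intro j
    rw [← hlen j, prod_range_getD (fun g => μ {g}), prod_map_gateWord, ← add_mul,
      Nat.add_sub_cancel' j.2.le]
  · intro j j' h
    have : gateWord la lb (j * s) n ((50 - j) * s) = gateWord la lb (j' * s) n ((50 - j') * s) := by
      refine List.ext_getElem (by rw [hlen, hlen]) fun i h1 h2 => ?_
      have := h i (by rw [← hlen j]; exact h1)
      simpa [h1, h2] using this
    exact hinj j j' (by rw [hadef, hbdef, ← prod_gateWord, ← prod_gateWord, this])
  · intro j h x₁ x₂ y₁ y₂ hx₁ hx₂ hy₁ hy₂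
    have l1 : ((List.replicate (j * s) lb).flatten).length = j * s * lb.length := by simp
    have l2 : ((List.replicate (j * s) lb).flatten ++ (List.replicate n la).flatten).length =
      j * s * lb.length + n * la.length := by simp
    have hz : b ^ ((j : ℤ) * s) = b ^ ((j : ℕ) * s) := by
      rw [← zpow_natCast]; push_cast; rfl
    have p1 : prefixProd (fun t => (gateWord la lb (j * s) n ((50 - j) * s)).getD t 1)
        (j * s * lb.length) = b ^ ((j : ℤ) * s) := by
      rw [prefixProd_getD _ (by rw [hlen]; exact (hle j).trans (Nat.le_add_right _ _)), gateWord,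
        List.append_assoc, ← l1, List.take_left, prod_flatten_replicate, hz]
    have p2 : prefixProd (fun t => (gateWord la lb (j * s) n ((50 - j) * s)).getD t 1)
        (j * s * lb.length + n * la.length) = b ^ ((j : ℤ) * s) * a ^ (n : ℤ) := by
      rw [prefixProd_getD _ (by rw [hlen]; exact Nat.add_le_add_right (hle j) _), gateWord,
        ← l2, List.take_left, List.prod_append, prod_flatten_replicate, prod_flatten_replicate, hz,
        zpow_natCast]
    have p3 : prefixProd (fun t => (gateWord la lb (j * s) n ((50 - j) * s)).getD t 1)
        (50 * s * lb.length + n * la.length) =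
          b ^ ((j : ℤ) * s) * a ^ (n : ℤ) * b ^ (-(((j : ℤ) - 50) * s)) := by
      rw [← hlen j, prefixProd_getD _ le_rfl, List.take_length, prod_gateWord, hz, zpow_natCast]
      congr 1
      rw [← zpow_natCast]
      congr 1
      push_cast [Nat.cast_sub j.2.le]
      ring
    have start : ∀ x, ProjNear D (b ^ ((j : ℤ) * s) • axis o a) (b ^ ((j : ℤ) * s) • o) (h⁻¹ • x) →
        ProjNear D ((h * b ^ ((j : ℤ) * s)) • axis o a) ((h * b ^ ((j : ℤ) * s)) • o) x := by
      intro x hx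
      rw [← projNear_smul_iff h, smul_inv_smul] at hx
      rwa [mul_smul, mul_smul]
    have fin : ∀ y, ProjNear D (b ^ (((j : ℤ) - 50) * s) • axis o a) (b ^ (((j : ℤ) - 50) * s) • o)
        ((h * (b ^ ((j : ℤ) * s) * a ^ (n : ℤ) * b ^ (-(((j : ℤ) - 50) * s))))⁻¹ • y) →
        ProjNear D ((h * b ^ ((j : ℤ) * s)) • axis o a)
          ((h * (b ^ ((j : ℤ) * s) * a ^ (n : ℤ))) • o) y := by
      intro y hy
      rw [← projNear_smul_iff (h * (b ^ ((j : ℤ) * s) * a ^ (n : ℤ) *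
        b ^ (-(((j : ℤ) - 50) * s)))), smul_inv_smul, ← mul_smul, ← mul_smul, mul_assoc h,
        mul_assoc (b ^ ((j : ℤ) * s) * a ^ (n : ℤ)), ← zpow_add, neg_add_cancel, zpow_zero,
        mul_one] at hy
      rw [← mul_assoc, mul_smul _ (a ^ (n : ℤ)) (axis o a), zpow_smul_axis, mul_assoc] at hy
      exact hy
    rw [p3] at hy₁ hy₂
    simp only [p1, p2]
    refine ⟨(h * b ^ ((j : ℤ) * s)) • axis o a, ⟨hA.2.smul _, ?_, ?_, ?_⟩, start _ hx₁,
      start _ hx₂, fin _ hy₁, fin _ hy₂⟩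
    · exact Set.smul_mem_smul_set (a := h * b ^ ((j : ℤ) * s)) (mem_axis_self o a)
    · rw [← mul_assoc, mul_smul _ (a ^ (n : ℤ)) o]
      exact Set.smul_mem_smul_set (a := h * b ^ ((j : ℤ) * s)) (zpow_smul_mem_axis o a n)
    · rw [← mul_assoc, mul_smul _ (a ^ (n : ℤ)) o, dist_smul, zpow_natCast]

end Schottky
end ContractingWalk

/-! ### Resampling coordinates of a product measure -/

namespace ContractingWalk

section Resampling

variable {ι S : Type*} [MeasurableSpace S]

open Classical in
/-- Replacing a block of coordinates by those of an independent copy preserves the product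
measure. -/
theorem measurePreserving_piecewise (μ : Measure S) [IsProbabilityMeasure μ] (J : Set ι) :
    MeasurePreserving (fun q : (ι → S) × (ι → S) => J.piecewise q.2 q.1)
      ((Measure.infinitePi fun _ : ι => μ).prod (Measure.infinitePi fun _ : ι => μ))
      (Measure.infinitePi fun _ : ι => μ) := by
  have hm : Measurable (fun q : (ι → S) × (ι → S) => J.piecewise q.2 q.1) := by
    refine measurable_pi_lambda _ fun i => ?_
    by_cases hi : i ∈ J
    · simp only [Set.piecewise, if_pos hi]
      exact (measurable_pi_apply i).comp measurable_snd
    · simp only [Set.piecewise, if_neg hi]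
      exact (measurable_pi_apply i).comp measurable_fst
  refine ⟨hm, Measure.eq_infinitePi _ fun s t ht => ?_⟩
  have hms : ∀ u : Finset ι, MeasurableSet (Set.pi (u : Set ι) t) := fun u =>
    MeasurableSet.pi u.countable_toSet fun i _ => ht i
  rw [Measure.map_apply hm (hms s)]
  have : (fun q : (ι → S) × (ι → S) => J.piecewise q.2 q.1) ⁻¹' (Set.pi s t) =
      Set.pi (s.filter (· ∉ J) : Finset ι) t ×ˢ Set.pi (s.filter (· ∈ J) : Finset ι) t := by
    ext ⟨ω, ω'⟩
    simp only [Set.mem_preimage, Set.mem_pi, Set.mem_prod, Finset.coe_filter, Finset.mem_coe]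
    constructor
    · intro h
      exact ⟨fun i hi => by simpa [hi.2] using h i hi.1, fun i hi => by simpa [hi.2] using h i hi.1⟩
    · rintro ⟨h1, h2⟩ i hi
      by_cases hJ : i ∈ J
      · simpa [hJ] using h2 i ⟨hi, hJ⟩
      · simpa [hJ] using h1 i ⟨hi, hJ⟩
  rw [this, Measure.prod_prod, Measure.infinitePi_pi _ (fun i _ => ht i),
    Measure.infinitePi_pi _ (fun i _ => ht i), mul_comm]
  exact Finset.prod_filter_mul_prod_filter_not s (· ∈ J) _

open Classical in
/-- If `f` does not depend on the coordinates in `J`, and the integral of `φ` over these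
coordinates is at most `c` whatever the other ones are, then `∫ f * φ ≤ c * ∫ f`. -/
theorem lintegral_mul_le_of_resample {μ : Measure S} [IsProbabilityMeasure μ] {J : Set ι}
    {f φ : (ι → S) → ℝ≥0∞} {c : ℝ≥0∞} (hf : Measurable f) (hφ : Measurable φ)
    (hfJ : DependsOn f Jᶜ)
    (hc : ∀ ω, ∫⁻ ω', φ (J.piecewise ω' ω) ∂(Measure.infinitePi fun _ : ι => μ) ≤ c) :
    ∫⁻ ω, f ω * φ ω ∂(Measure.infinitePi fun _ : ι => μ) ≤
      c * ∫⁻ ω, f ω ∂(Measure.infinitePi fun _ : ι => μ) := by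
  have hmp := measurePreserving_piecewise (ι := ι) μ J
  have hfφ : Measurable fun ω => f ω * φ ω := hf.mul hφ
  have hcomp : Measurable fun q : (ι → S) × (ι → S) =>
      f (J.piecewise q.2 q.1) * φ (J.piecewise q.2 q.1) := hfφ.comp hmp.measurable
  rw [← hmp.lintegral_comp hfφ, lintegral_prod _ hcomp.aemeasurable,
    ← lintegral_const_mul _ hf]
  refine lintegral_mono fun ω => ?_
  have h : ∀ ω', f (J.piecewise ω' ω) = f ω := fun ω' => hfJ fun i hi => by
    simp [Set.piecewise, (show i ∉ J from hi)]
  simp only [h]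
  have hsec : Measurable fun ω' => φ (J.piecewise ω' ω) :=
    hφ.comp (hmp.measurable.comp (measurable_prodMk_left (x := ω)))
  rw [lintegral_const_mul _ hsec, mul_comm]
  exact mul_le_mul_left (hc ω) _

open Classical in
/-- Iterated form of `lintegral_mul_le_of_resample`: integrate the factors of a product one after
the other, where each factor depends only on its own block of coordinates and on coordinates
outside of the later blocks. -/
theorem lintegral_mul_prod_le {κ : Type*} [LinearOrder κ] {μ : Measure S} [IsProbabilityMeasure μ]
    (T : Finset κ) {J : κ → Set ι} {f : (ι → S) → ℝ≥0∞} {φ : κ → (ι → S) → ℝ≥0∞} {c : ℝ≥0∞}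
    (hf : Measurable f) (hφ : ∀ i ∈ T, Measurable (φ i))
    (hfJ : ∀ i ∈ T, DependsOn f (J i)ᶜ)
    (hφJ : ∀ i ∈ T, ∀ i' ∈ T, i' < i → DependsOn (φ i') (J i)ᶜ)
    (hc : ∀ i ∈ T, ∀ ω,
      ∫⁻ ω', φ i ((J i).piecewise ω' ω) ∂(Measure.infinitePi fun _ : ι => μ) ≤ c) :
    ∫⁻ ω, f ω * ∏ i ∈ T, φ i ω ∂(Measure.infinitePi fun _ : ι => μ) ≤
      c ^ T.card * ∫⁻ ω, f ω ∂(Measure.infinitePi fun _ : ι => μ) := by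
  induction T using Finset.induction_on_max with
  | empty => simp
  | insert a T ha ih =>
    have haT : a ∉ T := fun h => lt_irrefl _ (ha a h)
    have hsub : T ⊆ insert a T := Finset.subset_insert _ _
    have hmem := Finset.mem_insert_self a T
    simp only [Finset.prod_insert haT, Finset.card_insert_of_notMem haT]
    calc ∫⁻ ω, f ω * (φ a ω * ∏ i ∈ T, φ i ω) ∂(Measure.infinitePi fun _ : ι => μ)
        = ∫⁻ ω, (f ω * ∏ i ∈ T, φ i ω) * φ a ω ∂(Measure.infinitePi fun _ : ι => μ) := by
          simp only [mul_assoc, mul_comm (φ a _)]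
      _ ≤ c * ∫⁻ ω, f ω * ∏ i ∈ T, φ i ω ∂(Measure.infinitePi fun _ : ι => μ) := by
          refine lintegral_mul_le_of_resample (hf.mul ?_) (hφ a hmem) ?_ (hc a hmem)
          · exact Finset.measurable_prod T fun i hi => hφ i (hsub hi)
          · intro ω ω' h
            simp only
            rw [hfJ a hmem h]
            congr 1
            exact Finset.prod_congr rfl fun i hi => hφJ a hmem i (hsub hi) (ha i hi) h
      _ ≤ c * (c ^ T.card * ∫⁻ ω, f ω ∂(Measure.infinitePi fun _ : ι => μ)) := by
          gcongr
          exact ih (fun i hi => hφ i (hsub hi)) (fun i hi => hfJ i (hsub hi))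
            (fun i hi i' hi' => hφJ i (hsub hi) i' (hsub hi')) (fun i hi => hc i (hsub hi))
      _ = _ := by rw [pow_succ']; ring

end Resampling

/-! ### The bi-infinite path -/

section Path

variable {G : Type*} [Group G]

/-- The bi-infinite path with `pathPos g n = ω_n`, for all integers `n`. -/
def pathPos (g : ℤ → G) : ℤ → G
  | Int.ofNat n => forwardWalk g n
  | Int.negSucc n => backwardWalk g (n + 1)

theorem pathPos_natCast (g : ℤ → G) (n : ℕ) : pathPos g n = forwardWalk g n := rfl

theorem pathPos_neg_natCast (g : ℤ → G) (n : ℕ) : pathPos g (-n) = backwardWalk g n := by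
  cases n with
  | zero => rfl
  | succ n => rfl

theorem pathPos_add_one (g : ℤ → G) (n : ℤ) : pathPos g (n + 1) = pathPos g n * g (n + 1) := by
  obtain ⟨k, rfl | rfl⟩ := n.eq_nat_or_neg
  · rw [pathPos_natCast, show (k : ℤ) + 1 = ((k + 1 : ℕ) : ℤ) by push_cast; rfl, pathPos_natCast]
    simp [forwardWalk, List.range_succ]
  · cases k with
    | zero =>
      change forwardWalk g 1 = forwardWalk g 0 * g _
      simp [forwardWalk]
    | succ k =>
      have h : -((k + 1 : ℕ) : ℤ) + 1 = -(k : ℤ) := by push_cast; ring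
      rw [h, pathPos_neg_natCast, pathPos_neg_natCast]
      simp [backwardWalk, List.range_succ]

theorem prefixProd_succ (w : ℕ → G) (t : ℕ) : prefixProd w (t + 1) = prefixProd w t * w t := by
  simp [prefixProd, List.range_succ]

theorem pathPos_add (g : ℤ → G) (n : ℤ) (t : ℕ) :
    pathPos g (n + t) = pathPos g n * prefixProd (fun i => g (n + 1 + i)) t := by
  induction t with
  | zero => simp [prefixProd]
  | succ t ih =>
    rw [prefixProd_succ, ← mul_assoc, ← ih, Nat.cast_succ, ← add_assoc, pathPos_add_one]
    congr 2
    ring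

theorem prefixProd_congr {w w' : ℕ → G} {t : ℕ} (h : ∀ i < t, w i = w' i) :
    prefixProd w t = prefixProd w' t := by
  unfold prefixProd
  congr 1
  exact List.map_congr_left fun i hi => h i (List.mem_range.1 hi)

theorem dependsOn_pathPos_inv_mul {m n : ℤ} (hmn : m ≤ n) :
    DependsOn (fun g : ℤ → G => (pathPos g m)⁻¹ * pathPos g n) (Set.Ioc m n) := by
  intro g g' h
  obtain ⟨t, rfl⟩ := Int.le.dest hmn
  simp only [pathPos_add, inv_mul_cancel_left]
  exact prefixProd_congr fun i hi => h _ ⟨by omega, by omega⟩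

theorem measurable_pathPos [Countable G] [MeasurableSpace G] [DiscreteMeasurableSpace G] (n : ℤ) :
    Measurable fun g : ℤ → G => pathPos g n := by
  have hmul : Measurable fun q : G × G => q.1 * q.2 := Measurable.of_discrete
  have hinv : Measurable fun q : G => q⁻¹ := Measurable.of_discrete
  obtain ⟨k, rfl | rfl⟩ := n.eq_nat_or_neg
  · simp only [pathPos_natCast, forwardWalk]
    induction k with
    | zero => simp
    | succ k ih =>
      simp only [List.range_succ, List.map_append, List.prod_append, List.map_cons, List.map_nil,
        List.prod_singleton]
      exact hmul.comp (ih.prodMk (measurable_pi_apply _))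
  · simp only [pathPos_neg_natCast, backwardWalk]
    induction k with
    | zero => simp
    | succ k ih =>
      simp only [List.range_succ, List.map_append, List.prod_append, List.map_cons, List.map_nil,
        List.prod_singleton]
      exact hmul.comp (ih.prodMk (hinv.comp (measurable_pi_apply _)))

end Path
end ContractingWalk

/-! ### Probability that a window contains no gate -/

namespace ContractingWalk

section Gates

variable {X G : Type*} [MetricSpace X] [Group G] [MulAction G X] [MeasurableSpace G]
  {o : X} {μ : Measure G} {K D ℓ : ℝ}

namespace SchottkySystem

/-- The `i`-th block of steps of the walk. -/
def block (S : SchottkySystem o μ K D ℓ) (i : ℤ) : Set ℤ := Set.Ioc (i * S.len) ((i + 1) * S.len)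

/-- The steps of the walk in the `i`-th block spell the `j`-th word. -/
def Reads (S : SchottkySystem o μ K D ℓ) (ω : ℤ → G) (i : ℤ) (j : Fin 50) : Prop :=
  ∀ t : ℕ, t < S.len → ω (i * S.len + 1 + t) = S.word j t

/-- The `i`-th block spells a word which is not excluded by any of the given points. -/
def HasGate (S : SchottkySystem o μ K D ℓ) (ω : ℤ → G) (i : ℤ) (x₁ x₂ y₁ y₂ : X) : Prop :=
  ∃ j, S.Reads ω i j ∧
    (S.startOK j ((pathPos ω (i * S.len))⁻¹ • x₁) ∧ S.startOK j ((pathPos ω (i * S.len))⁻¹ • x₂)) ∧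
    (S.endOK j ((pathPos ω ((i + 1) * S.len))⁻¹ • y₁) ∧
      S.endOK j ((pathPos ω ((i + 1) * S.len))⁻¹ • y₂))

theorem HasGate.exists_separates {S : SchottkySystem o μ K D ℓ} {ω : ℤ → G} {i : ℤ}
    {x₁ x₂ y₁ y₂ : X} (h : S.HasGate ω i x₁ x₂ y₁ y₂) :
    ∃ α : Set X, ∃ t t' : ℕ, t ≤ S.len ∧ t' ≤ S.len ∧
      Separates K D ℓ α (pathPos ω (i * S.len + t) • o) (pathPos ω (i * S.len + t') • o)
        x₁ x₂ y₁ y₂ := by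
  obtain ⟨j, hj, ⟨hx₁, hx₂⟩, hy₁, hy₂⟩ := h
  have hp : ∀ t : ℕ, t ≤ S.len → pathPos ω (i * S.len + t) =
      pathPos ω (i * S.len) * prefixProd (S.word j) t := by
    intro t ht
    rw [pathPos_add]
    congr 1
    exact prefixProd_congr fun k hk => hj k (hk.trans_le ht)
  have he : pathPos ω ((i + 1) * S.len) =
      pathPos ω (i * S.len) * prefixProd (S.word j) S.len := by
    rw [← hp _ le_rfl]; congr 1; ring
  rw [he] at hy₁ hy₂
  obtain ⟨α, hα⟩ := S.exists_separates j _ _ _ _ _ hx₁ hx₂ hy₁ hy₂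
  exact ⟨α, S.entry j, S.exit j, S.entry_le j, S.exit_le j, by
    rwa [hp _ (S.entry_le j), hp _ (S.exit_le j)]⟩

theorem Reads.unique {S : SchottkySystem o μ K D ℓ} {ω : ℤ → G} {i : ℤ} {j j' : Fin 50}
    (h : S.Reads ω i j) (h' : S.Reads ω i j') : j = j' :=
  S.word_injective j j' fun t ht => (h t ht).symm.trans (h' t ht)

theorem reads_congr (S : SchottkySystem o μ K D ℓ) {ω ω' : ℤ → G} {i : ℤ}
    (h : ∀ c ∈ S.block i, ω c = ω' c) (j : Fin 50) : S.Reads ω i j ↔ S.Reads ω' i j := by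
  unfold Reads
  refine forall₂_congr fun t ht => ?_
  rw [h _ ⟨by omega, by
    have : ((t : ℤ)) < S.len := by exact_mod_cast ht
    linarith⟩]

theorem setOf_reads_eq (S : SchottkySystem o μ K D ℓ) (i : ℤ) (j : Fin 50) :
    {ω | S.Reads ω i j} =
      Set.pi ((Finset.range S.len).image fun t : ℕ => i * S.len + 1 + t : Finset ℤ)
        fun c => {S.word j (c - (i * S.len + 1)).toNat} := by
  ext ω
  simp only [Set.mem_ofPred_eq, Set.mem_pi, Finset.coe_image, Set.mem_image, Finset.mem_coe,
    Finset.mem_range, forall_exists_index, and_imp, forall_apply_eq_imp_iff₂, Reads,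
    Set.mem_singleton_iff, add_sub_cancel_left, Int.toNat_natCast]

open Classical in
/-- The weight of a block that spells a word excluded by one of two points (as expressed by `ok`)
is `5`, the weight of a block that spells another word is `1/5`, and the weight of the other
blocks is `1`. If a block creates no gate, then either the weight given by the past points or the
one given by the future points is `5`, so that the product of both is at least `1`. On the other
hand, each weight has average smaller than `1`. -/
noncomputable def weight (S : SchottkySystem o μ K D ℓ) (i : ℤ) (ok : Fin 50 → X → Prop) (ω : ℤ → G)
    (z₁ z₂ : X) : ℝ≥0∞ :=
  if ∃ j, S.Reads ω i j ∧ ok j z₁ ∧ ok j z₂ then 5⁻¹ else if ∃ j, S.Reads ω i j then 5 else 1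

theorem weight_congr (S : SchottkySystem o μ K D ℓ) {ω ω' : ℤ → G} {i : ℤ}
    (h : ∀ c ∈ S.block i, ω c = ω' c) (ok : Fin 50 → X → Prop) (z₁ z₂ : X) :
    S.weight i ok ω z₁ z₂ = S.weight i ok ω' z₁ z₂ := by
  have e : S.Reads ω i = S.Reads ω' i := funext fun j => propext (S.reads_congr h j)
  unfold weight
  rw [e]

/-- The random point `x` depends, relatively to the position of the walk at time `n`, only on the
steps in `I` (and it does so in a measurable way, for the discrete `σ`-algebra). -/
structure SeenFrom (x : (ℤ → G) → X) (n : ℤ) (I : Set ℤ) : Prop where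
  dependsOn : DependsOn (fun ω => (pathPos ω n)⁻¹ • x ω) I
  measurableSet : ∀ s : Set X, MeasurableSet {ω | (pathPos ω n)⁻¹ • x ω ∈ s}

theorem SeenFrom.dependsOn_weight {S : SchottkySystem o μ K D ℓ} {x₁ x₂ : (ℤ → G) → X} {n : ℤ}
    {I : Set ℤ} (h₁ : SeenFrom x₁ n I) (h₂ : SeenFrom x₂ n I) (i : ℤ) (ok : Fin 50 → X → Prop) :
    DependsOn (fun ω => S.weight i ok ω ((pathPos ω n)⁻¹ • x₁ ω) ((pathPos ω n)⁻¹ • x₂ ω))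
      (I ∪ S.block i) := by
  intro ω ω' h
  have e₁ := h₁.dependsOn fun c hc => h c (Or.inl hc)
  have e₂ := h₂.dependsOn fun c hc => h c (Or.inl hc)
  simp only at e₁ e₂ ⊢
  rw [e₁, e₂]
  exact S.weight_congr (fun c hc => h c (Or.inr hc)) ok _ _

variable [DiscreteMeasurableSpace G]

theorem measurableSet_reads (S : SchottkySystem o μ K D ℓ) (i : ℤ) (j : Fin 50) :
    MeasurableSet {ω | S.Reads ω i j} := by
  rw [setOf_reads_eq]
  exact MeasurableSet.pi (Finset.countable_toSet _) fun _ _ => MeasurableSet.of_discrete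

theorem SeenFrom.measurable_weight {S : SchottkySystem o μ K D ℓ} {x₁ x₂ : (ℤ → G) → X} {n : ℤ}
    {I : Set ℤ} (h₁ : SeenFrom x₁ n I) (h₂ : SeenFrom x₂ n I) (i : ℤ) (ok : Fin 50 → X → Prop) :
    Measurable fun ω => S.weight i ok ω ((pathPos ω n)⁻¹ • x₁ ω) ((pathPos ω n)⁻¹ • x₂ ω) := by
  unfold weight
  have hm : ∀ j, MeasurableSet {ω | S.Reads ω i j} := S.measurableSet_reads i
  refine Measurable.ite ?_ measurable_const (Measurable.ite ?_ measurable_const measurable_const)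
  · rw [Set.ofPred_exists]
    exact MeasurableSet.iUnion fun j => (hm j).inter
      ((h₁.measurableSet {x | ok j x}).inter (h₂.measurableSet {x | ok j x}))
  · rw [Set.ofPred_exists]
    exact MeasurableSet.iUnion hm

variable [IsProbabilityMeasure μ]

theorem measure_reads (S : SchottkySystem o μ K D ℓ) (i : ℤ) (j : Fin 50) :
    stepMeasure μ {ω | S.Reads ω i j} = S.mass := by
  rw [setOf_reads_eq, stepMeasure, Measure.infinitePi_pi _ fun _ _ => MeasurableSet.of_discrete,
    Finset.prod_image fun a _ b _ h => by simpa using h, ← S.prod_eq_mass j]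
  simp

instance : IsProbabilityMeasure (stepMeasure μ) := by unfold stepMeasure; infer_instance

theorem measure_exists_reads (S : SchottkySystem o μ K D ℓ) (i : ℤ) :
    stepMeasure μ {ω | ∃ j, S.Reads ω i j} = 50 * S.mass := by
  have : {ω : ℤ → G | ∃ j, S.Reads ω i j} = ⋃ j, {ω | S.Reads ω i j} := by
    ext; simp
  rw [this, measure_iUnion _ fun j => S.measurableSet_reads i j]
  · simp [measure_reads]
  · intro j j' hjj'
    exact Set.disjoint_left.2 fun ω h h' => hjj' (h.unique h')

theorem mass_le (S : SchottkySystem o μ K D ℓ) : 50 * S.mass ≤ 1 := by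
  rw [← S.measure_exists_reads 0]; exact prob_le_one

/-- The average weight of a block, relative to given points: two points exclude at most two of the
fifty words, so the weights of the words add up to at most `50 / 5 + 2 * 5 = 20`. -/
theorem lintegral_weight_le (S : SchottkySystem o μ K D ℓ) (i : ℤ) {ok : Fin 50 → X → Prop}
    (hok : ∀ x j j', ¬ ok j x → ¬ ok j' x → j = j') (z₁ z₂ : X) :
    ∫⁻ ω, S.weight i ok ω z₁ z₂ ∂(stepMeasure μ) ≤ 1 - 30 * S.mass := by
  classical
  set A : Set (ℤ → G) := {ω | ∃ j, S.Reads ω i j} with hA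
  have hAm : MeasurableSet A := by
    have : A = ⋃ j, {ω | S.Reads ω i j} := by ext; simp [hA]
    rw [this]
    exact MeasurableSet.iUnion fun j => S.measurableSet_reads i j
  set c : Fin 50 → ℝ≥0∞ := fun j => if ok j z₁ ∧ ok j z₂ then 5⁻¹ else 5 with hc
  have h1 : ∀ ω, S.weight i ok ω z₁ z₂ ≤ Aᶜ.indicator 1 ω +
      ∑ j, {ω | S.Reads ω i j}.indicator (fun _ => c j) ω := by
    intro ω
    by_cases hω : ω ∈ A
    · obtain ⟨j, hj⟩ := hω
      refine le_trans ?_ le_add_self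
      refine le_trans ?_ (Finset.single_le_sum (fun _ _ => zero_le) (Finset.mem_univ j))
      rw [Set.indicator_of_mem (show ω ∈ {ω | S.Reads ω i j} from hj)]
      simp only [weight, hc]
      by_cases hz : ok j z₁ ∧ ok j z₂
      · rw [if_pos ⟨j, hj, hz⟩, if_pos hz]
      · rw [if_neg hz, if_neg, if_pos ⟨j, hj⟩]
        rintro ⟨j', hj', hz'⟩
        rw [hj'.unique hj] at hz'
        exact hz hz'
    · refine le_trans ?_ le_self_add
      rw [Set.indicator_of_mem (show ω ∈ Aᶜ from hω)]
      have h2 : ¬ ∃ j, S.Reads ω i j ∧ ok j z₁ ∧ ok j z₂ := fun ⟨j, hj, _⟩ => hω ⟨j, hj⟩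
      have h3 : ¬ ∃ j, S.Reads ω i j := hω
      simp [weight, h2, h3]
  have h2 : ∑ j, c j ≤ 20 := by
    have hb : ∀ z, (Finset.univ.filter fun j => ¬ ok j z).card ≤ 1 := fun z =>
      Finset.card_le_one.2 fun j hj j' hj' =>
        hok z j j' (Finset.mem_filter.1 hj).2 (Finset.mem_filter.1 hj').2
    calc ∑ j, c j ≤ ∑ j : Fin 50, (5⁻¹ + ((if ¬ ok j z₁ then 5 else 0) +
          if ¬ ok j z₂ then 5 else 0) : ℝ≥0∞) := by
          refine Finset.sum_le_sum fun j _ => ?_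
          simp only [hc]
          by_cases h1 : ok j z₁
          · by_cases h2 : ok j z₂
            · simp [h1, h2]
            · simp [h1, h2]
          · simp only [h1, false_and, if_false, not_false_eq_true, if_true]
            exact le_add_left le_self_add
      _ = 50 * 5⁻¹ + ((Finset.univ.filter fun j => ¬ ok j z₁).card * 5 +
          (Finset.univ.filter fun j => ¬ ok j z₂).card * 5) := by
          rw [Finset.sum_add_distrib, Finset.sum_add_distrib, ← Finset.sum_filter,
            ← Finset.sum_filter]
          simp
      _ ≤ 50 * 5⁻¹ + ((1 : ℕ) * 5 + (1 : ℕ) * 5) := by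
          gcongr <;> exact hb _
      _ = 20 := by
          rw [show (50 : ℝ≥0∞) = 10 * 5 by norm_num, mul_assoc,
            ENNReal.mul_inv_cancel (by norm_num) (by norm_num)]
          norm_num
  have h50 := S.mass_le
  have hmt : S.mass ≠ ∞ := fun h => by simp [h] at h50
  calc ∫⁻ ω, S.weight i ok ω z₁ z₂ ∂(stepMeasure μ)
      ≤ ∫⁻ ω, (Aᶜ.indicator 1 ω + ∑ j, {ω | S.Reads ω i j}.indicator (fun _ => c j) ω)
          ∂(stepMeasure μ) := lintegral_mono h1
    _ = (1 - 50 * S.mass) + ∑ j, c j * S.mass := by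
        rw [lintegral_add_left (measurable_one.indicator hAm.compl), lintegral_indicator_one
          hAm.compl, prob_compl_eq_one_sub hAm, hA, S.measure_exists_reads,
          lintegral_finsetSum _ fun j _ => measurable_const.indicator (S.measurableSet_reads i j)]
        congr 1
        refine Finset.sum_congr rfl fun j _ => ?_
        rw [lintegral_indicator_const (S.measurableSet_reads i j), S.measure_reads]
    _ ≤ (1 - 50 * S.mass) + 20 * S.mass := by
        rw [← Finset.sum_mul]; gcongr
    _ ≤ 1 - 30 * S.mass := by
        refine ENNReal.le_sub_of_add_le_right (ENNReal.mul_ne_top (by norm_num) hmt) ?_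
        rw [add_assoc, ← add_mul, show (20 + 30 : ℝ≥0∞) = 50 by norm_num, tsub_add_cancel_of_le h50]

open Classical in
theorem SeenFrom.lintegral_piecewise_weight_le {S : SchottkySystem o μ K D ℓ}
    {x₁ x₂ : (ℤ → G) → X} {n i : ℤ} {I : Set ℤ} (h₁ : SeenFrom x₁ n I) (h₂ : SeenFrom x₂ n I)
    (hI : Disjoint I (S.block i)) {ok : Fin 50 → X → Prop}
    (hok : ∀ x j j', ¬ ok j x → ¬ ok j' x → j = j') (ω : ℤ → G) :
    ∫⁻ ω', S.weight i ok ((S.block i).piecewise ω' ω)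
      ((pathPos ((S.block i).piecewise ω' ω) n)⁻¹ • x₁ ((S.block i).piecewise ω' ω))
      ((pathPos ((S.block i).piecewise ω' ω) n)⁻¹ • x₂ ((S.block i).piecewise ω' ω))
      ∂(stepMeasure μ) ≤ 1 - 30 * S.mass := by
  have e : ∀ ω', ∀ c ∈ I, (S.block i).piecewise ω' ω c = ω c := fun ω' c hc =>
    Set.piecewise_eq_of_notMem _ _ _ (Set.disjoint_left.1 hI hc)
  have e₁ := fun ω' => h₁.dependsOn (e ω')
  have e₂ := fun ω' => h₂.dependsOn (e ω')
  simp only at e₁ e₂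
  simp only [e₁, e₂]
  refine le_trans (le_of_eq ?_) (S.lintegral_weight_le i hok ((pathPos ω n)⁻¹ • x₁ ω)
    ((pathPos ω n)⁻¹ • x₂ ω))
  exact lintegral_congr fun ω' => S.weight_congr
    (fun c hc => Set.piecewise_eq_of_mem _ _ _ hc) ok _ _

/-- The probability that no block of a window creates a gate decays exponentially with the size of
the window. The density `f` gives the same bound conditionally on steps outside of the
window. -/
theorem setLIntegral_no_gate_le (S : SchottkySystem o μ K D ℓ) (T : Finset ℤ)
    {x₁ x₂ y₁ y₂ : (ℤ → G) → X} {f : (ℤ → G) → ℝ≥0∞} (hf : Measurable f)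
    (hfT : ∀ i ∈ T, DependsOn f (S.block i)ᶜ)
    (hx₁ : ∀ i ∈ T, SeenFrom x₁ (i * S.len) (Set.Iic (i * S.len)))
    (hx₂ : ∀ i ∈ T, SeenFrom x₂ (i * S.len) (Set.Iic (i * S.len)))
    (hy₁ : ∀ i ∈ T, SeenFrom y₁ ((i + 1) * S.len) (Set.Ioi ((i + 1) * S.len)))
    (hy₂ : ∀ i ∈ T, SeenFrom y₂ ((i + 1) * S.len) (Set.Ioi ((i + 1) * S.len))) :
    ∫⁻ ω in {ω | ∀ i ∈ T, ¬ S.HasGate ω i (x₁ ω) (x₂ ω) (y₁ ω) (y₂ ω)}, f ω ∂(stepMeasure μ) ≤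
      2 * (1 - 30 * S.mass) ^ T.card * ∫⁻ ω, f ω ∂(stepMeasure μ) := by
  classical
  set φ : ℤ → (ℤ → G) → ℝ≥0∞ := fun i ω => S.weight i S.startOK ω
    ((pathPos ω (i * S.len))⁻¹ • x₁ ω) ((pathPos ω (i * S.len))⁻¹ • x₂ ω) with hφ
  set ψ : ℤ → (ℤ → G) → ℝ≥0∞ := fun i ω => S.weight i S.endOK ω
    ((pathPos ω ((i + 1) * S.len))⁻¹ • y₁ ω) ((pathPos ω ((i + 1) * S.len))⁻¹ • y₂ ω) with hψ
  have hφm : ∀ i ∈ T, Measurable (φ i) := fun i hi =>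
    (hx₁ i hi).measurable_weight (hx₂ i hi) i S.startOK
  have hψm : ∀ i ∈ T, Measurable (ψ i) := fun i hi =>
    (hy₁ i hi).measurable_weight (hy₂ i hi) i S.endOK
  have hlen : (0 : ℤ) < S.len := by exact_mod_cast S.len_pos
  have hblock : ∀ i i' : ℤ, i' < i → (i' + 1) * S.len ≤ i * S.len := fun i i' h =>
    mul_le_mul_of_nonneg_right (by omega) hlen.le
  have hstep : ∀ i : ℤ, i * S.len ≤ (i + 1) * S.len := fun i =>
    mul_le_mul_of_nonneg_right (by omega) hlen.le
  have b1 := lintegral_mul_prod_le T (J := S.block) (c := 1 - 30 * S.mass) hf hφm hfT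
    (fun i _ i' hi' hlt => DependsOn.mono ?_
      ((hx₁ i' hi').dependsOn_weight (hx₂ i' hi') i' S.startOK))
    (fun i hi ω => (hx₁ i hi).lintegral_piecewise_weight_le (hx₂ i hi) ?_ S.start_unique ω)
  rotate_left
  · rintro c (hc | hc) hcb
    · exact absurd hcb.1 (not_lt.2 (le_trans hc ((hstep i').trans (hblock i i' hlt))))
    · exact absurd hcb.1 (not_lt.2 (hc.2.trans (hblock i i' hlt)))
  · exact Set.disjoint_left.2 fun c hc hcb => absurd hcb.1 (not_lt.2 hc)
  have b2 := lintegral_mul_prod_le (κ := ℤᵒᵈ) T (J := S.block) (c := 1 - 30 * S.mass) hf hψm hfT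
    (fun i _ i' hi' hlt => DependsOn.mono ?_
      ((hy₁ i' hi').dependsOn_weight (hy₂ i' hi') i' S.endOK))
    (fun i hi ω => (hy₁ i hi).lintegral_piecewise_weight_le (hy₂ i hi) ?_ S.end_unique ω)
  rotate_left
  · rintro c (hc | hc) hcb
    · exact absurd hcb.2 (not_le.2 (lt_of_le_of_lt ((hblock i' i hlt).trans (hstep i')) hc))
    · exact absurd hcb.2 (not_le.2 (lt_of_le_of_lt (hblock i' i hlt) hc.1))
  · exact Set.disjoint_left.2 fun c hc hcb => absurd hcb.2 (not_le.2 hc)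
  have b2 : ∫⁻ ω, f ω * ∏ i ∈ T, ψ i ω ∂(stepMeasure μ) ≤
      (1 - 30 * S.mass) ^ T.card * ∫⁻ ω, f ω ∂(stepMeasure μ) := b2
  have hpt : ∀ ω ∈ {ω | ∀ i ∈ T, ¬ S.HasGate ω i (x₁ ω) (x₂ ω) (y₁ ω) (y₂ ω)},
      f ω ≤ f ω * ∏ i ∈ T, φ i ω + f ω * ∏ i ∈ T, ψ i ω := by
    intro ω hω
    have hprod : 1 ≤ (∏ i ∈ T, φ i ω) * ∏ i ∈ T, ψ i ω := by
      rw [← Finset.prod_mul_distrib]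
      refine Finset.one_le_prod' fun i hi => ?_
      have hg := hω i hi
      have h5 : (5⁻¹ : ℝ≥0∞) * 5 = 1 := ENNReal.inv_mul_cancel (by norm_num) (by norm_num)
      simp only [hφ, hψ, weight]
      by_cases hr : ∃ j, S.Reads ω i j
      · by_cases hL : ∃ j, S.Reads ω i j ∧ S.startOK j ((pathPos ω (i * S.len))⁻¹ • x₁ ω) ∧
            S.startOK j ((pathPos ω (i * S.len))⁻¹ • x₂ ω)
        · have hR : ¬ ∃ j, S.Reads ω i j ∧ S.endOK j ((pathPos ω ((i + 1) * S.len))⁻¹ • y₁ ω) ∧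
              S.endOK j ((pathPos ω ((i + 1) * S.len))⁻¹ • y₂ ω) := by
            rintro ⟨j, hj, hyj⟩
            obtain ⟨j', hj', hxj⟩ := hL
            rw [hj'.unique hj] at hxj
            exact hg ⟨j, hj, hxj, hyj⟩
          rw [if_pos hL, if_neg hR, if_pos hr, h5]
        · rw [if_neg hL, if_pos hr]
          split_ifs
          · rw [mul_comm, h5]
          · norm_num
      · have hL : ¬ ∃ j, S.Reads ω i j ∧ S.startOK j ((pathPos ω (i * S.len))⁻¹ • x₁ ω) ∧
            S.startOK j ((pathPos ω (i * S.len))⁻¹ • x₂ ω) := fun ⟨j, hj, _⟩ => hr ⟨j, hj⟩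
        have hR : ¬ ∃ j, S.Reads ω i j ∧ S.endOK j ((pathPos ω ((i + 1) * S.len))⁻¹ • y₁ ω) ∧
            S.endOK j ((pathPos ω ((i + 1) * S.len))⁻¹ • y₂ ω) := fun ⟨j, hj, _⟩ => hr ⟨j, hj⟩
        rw [if_neg hL, if_neg hr, if_neg hR, one_mul]
    rw [← mul_add]
    refine le_mul_of_one_le_right' ?_
    by_contra hcon
    have h1 : ∏ i ∈ T, φ i ω < 1 := lt_of_le_of_lt le_self_add (not_le.1 hcon)
    have h2 : ∏ i ∈ T, ψ i ω < 1 := lt_of_le_of_lt le_add_self (not_le.1 hcon)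
    exact absurd hprod (not_le.2 (mul_lt_one_of_nonneg_of_lt_one_left zero_le h1 h2.le))
  calc ∫⁻ ω in {ω | ∀ i ∈ T, ¬ S.HasGate ω i (x₁ ω) (x₂ ω) (y₁ ω) (y₂ ω)}, f ω ∂(stepMeasure μ)
      ≤ ∫⁻ ω in {ω | ∀ i ∈ T, ¬ S.HasGate ω i (x₁ ω) (x₂ ω) (y₁ ω) (y₂ ω)},
          (f ω * ∏ i ∈ T, φ i ω + f ω * ∏ i ∈ T, ψ i ω) ∂(stepMeasure μ) :=
        setLIntegral_mono ((hf.mul (Finset.measurable_prod T hφm)).add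
          (hf.mul (Finset.measurable_prod T hψm))) hpt
    _ ≤ ∫⁻ ω, (f ω * ∏ i ∈ T, φ i ω + f ω * ∏ i ∈ T, ψ i ω) ∂(stepMeasure μ) :=
        setLIntegral_le_lintegral _ _
    _ = ∫⁻ ω, f ω * ∏ i ∈ T, φ i ω ∂(stepMeasure μ) +
          ∫⁻ ω, f ω * ∏ i ∈ T, ψ i ω ∂(stepMeasure μ) :=
        lintegral_add_left (hf.mul (Finset.measurable_prod T hφm)) _
    _ ≤ _ := (add_le_add b1 b2).trans_eq (by rw [stepMeasure, ← two_mul, ← mul_assoc])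

end SchottkySystem

end Gates
end ContractingWalk

/-! ### Bad events -/

namespace ContractingWalk

theorem exists_pow_mul_le {ρ θ : ℝ} (hρ : 0 < ρ) (hρθ : ρ < θ) (d : ℕ) :
    ∃ C : ℝ, 0 < C ∧ ∀ n : ℕ, ((n : ℝ) + 1) ^ d * ρ ^ n ≤ C * θ ^ n := by
  have hθ : 0 < θ := hρ.trans hρθ
  have hr : 0 < ρ / θ := div_pos hρ hθ
  have hr1 : ρ / θ < 1 := (div_lt_one hθ).2 hρθ
  have hs := summable_pow_mul_geometric_of_norm_lt_one d
    (show ‖ρ / θ‖ < 1 by rwa [Real.norm_of_nonneg hr.le])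
  have hnn : ∀ n : ℕ, 0 ≤ (n : ℝ) ^ d * (ρ / θ) ^ n := fun n => by positivity
  refine ⟨(∑' n : ℕ, (n : ℝ) ^ d * (ρ / θ) ^ n + 1) / (ρ / θ), ?_, fun n => ?_⟩
  · have : 0 ≤ ∑' n : ℕ, (n : ℝ) ^ d * (ρ / θ) ^ n := tsum_nonneg hnn
    positivity
  · have h1 := hs.le_tsum (n + 1) fun m _ => hnn m
    rw [div_mul_eq_mul_div, le_div_iff₀ hr]
    have h2 : ((n : ℝ) + 1) ^ d * ρ ^ n * (ρ / θ) =
        (((n + 1 : ℕ) : ℝ) ^ d * (ρ / θ) ^ (n + 1)) * θ ^ n := by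
      push_cast
      rw [pow_succ (ρ / θ), div_pow]
      field_simp
    rw [h2]
    have : 0 < θ ^ n := by positivity
    nlinarith

/-- The union over all scales `r ≥ k` of a family of events indexed by the times comparable to
`r * M` (three times, the first of which is at least `2 * r * M`). -/
def scaleUnion {Ω : Type*} (M : ℕ) (E : ℕ → ℕ → ℕ → ℕ → Set Ω) (k : ℕ) : Set Ω :=
  ⋃ r : ℕ, ⋃ t ∈ Finset.range (6 * (k + r) * M + 1), ⋃ m₁ ∈ Finset.range (2 * (k + r) * M + 1),
    ⋃ m₂ ∈ Finset.range (2 * (k + r) * M + 1), E (k + r) (2 * (k + r) * M + t) m₁ m₂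

theorem mem_scaleUnion {Ω : Type*} {M : ℕ} {E : ℕ → ℕ → ℕ → ℕ → Set Ω} {k : ℕ} {ω : Ω}
    {r t m₁ m₂ : ℕ} (hr : k ≤ r) (ht : 2 * r * M ≤ t) (ht' : t ≤ 8 * r * M)
    (h₁ : m₁ ≤ 2 * r * M) (h₂ : m₂ ≤ 2 * r * M) (h : ω ∈ E r t m₁ m₂) :
    ω ∈ scaleUnion M E k := by
  obtain ⟨r, rfl⟩ := Nat.exists_eq_add_of_le hr
  obtain ⟨t, rfl⟩ := Nat.exists_eq_add_of_le ht
  simp only [scaleUnion, Set.mem_iUnion, Finset.mem_range]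
  refine ⟨r, t, ?_, m₁, by omega, m₂, by omega, h⟩
  have : 8 * (k + r) * M = 2 * (k + r) * M + 6 * (k + r) * M := by ring
  omega

theorem setLIntegral_biUnion_finset_le {Ω ι : Type*} [MeasurableSpace Ω] {P : Measure Ω}
    (s : Finset ι) (E : ι → Set Ω) (f : Ω → ℝ≥0∞) {c : ℝ≥0∞}
    (h : ∀ i ∈ s, ∫⁻ ω in E i, f ω ∂P ≤ c) : ∫⁻ ω in ⋃ i ∈ s, E i, f ω ∂P ≤ s.card * c := by
  classical
  induction s using Finset.induction_on with
  | empty => simp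
  | insert a s ha ih =>
    rw [Finset.set_biUnion_insert, Finset.card_insert_of_notMem ha, Nat.cast_succ, add_mul, one_mul,
      add_comm]
    exact (lintegral_union_le f _ _).trans (add_le_add (h a (Finset.mem_insert_self _ _))
      (ih fun i hi => h i (Finset.mem_insert_of_mem hi)))

/-- If the events at scale `r` are exponentially unlikely in `r`, so is their union over all scales
`r ≥ k`, because there are only polynomially many of them. -/
theorem exists_setLIntegral_scaleUnion_le {ρ : ℝ≥0∞} (hρ0 : ρ ≠ 0) (hρ1 : ρ < 1) (M : ℕ) :
    ∃ C θ : ℝ, 0 < C ∧ 0 < θ ∧ θ < 1 ∧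
      ∀ {Ω : Type*} [MeasurableSpace Ω] (P : Measure Ω) (E : ℕ → ℕ → ℕ → ℕ → Set Ω)
        (f : Ω → ℝ≥0∞), (∀ r t m₁ m₂, ∫⁻ ω in E r (2 * r * M + t) m₁ m₂, f ω ∂P ≤
          2 * ρ ^ (r - 2) * ∫⁻ ω, f ω ∂P) →
        ∀ k, ∫⁻ ω in scaleUnion M E k, f ω ∂P ≤ ENNReal.ofReal (C * θ ^ k) * ∫⁻ ω, f ω ∂P := by
  lift ρ to NNReal using (hρ1.trans ENNReal.one_lt_top).ne
  set q : ℝ := (ρ : ℝ) with hq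
  have hq0 : 0 < q := by
    have : ρ ≠ 0 := by simpa using hρ0
    exact_mod_cast pos_iff_ne_zero.2 this
  have hq1 : q < 1 := by exact_mod_cast hρ1
  set θ := (1 + q) / 2 with hθ
  have hθ1 : θ < 1 := by rw [hθ]; linarith
  have hqθ : q < θ := by rw [hθ]; linarith
  have hθ0 : 0 < θ := hq0.trans hqθ
  obtain ⟨C, hC, hCb⟩ := exists_pow_mul_le hq0 hqθ 3
  set A : ℝ := (6 * M + 1) ^ 3 * 2 * (q ^ 2)⁻¹ * C with hA
  have hA0 : 0 < A := by positivity
  refine ⟨A / (1 - θ), θ, div_pos hA0 (by linarith), hθ0, hθ1, ?_⟩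
  intro Ω _ P E f hE k
  have hscale : ∀ r : ℕ, ((6 * r * M + 1 : ℕ) : ℝ≥0∞) * (((2 * r * M + 1 : ℕ) : ℝ≥0∞) *
      (((2 * r * M + 1 : ℕ) : ℝ≥0∞) * (2 * (ρ : ℝ≥0∞) ^ (r - 2)))) ≤
      ENNReal.ofReal (A * θ ^ r) := by
    intro r
    have e : ((6 * r * M + 1 : ℕ) : ℝ≥0∞) * (((2 * r * M + 1 : ℕ) : ℝ≥0∞) *
      (((2 * r * M + 1 : ℕ) : ℝ≥0∞) * (2 * (ρ : ℝ≥0∞) ^ (r - 2)))) =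
        ENNReal.ofReal ((6 * r * M + 1) * ((2 * r * M + 1) * ((2 * r * M + 1) *
          (2 * q ^ (r - 2))))) := by
      rw [ENNReal.ofReal_mul (by positivity), ENNReal.ofReal_mul (by positivity),
        ENNReal.ofReal_mul (by positivity), ENNReal.ofReal_mul (by positivity),
        ENNReal.ofReal_pow hq0.le, hq, ENNReal.ofReal_coe_nnreal]
      have h1 : ENNReal.ofReal (6 * (r : ℝ) * M + 1) = ((6 * r * M + 1 : ℕ) : ℝ≥0∞) := by
        rw [← ENNReal.ofReal_natCast]; push_cast; rfl
      have h2 : ENNReal.ofReal (2 * (r : ℝ) * M + 1) = ((2 * r * M + 1 : ℕ) : ℝ≥0∞) := by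
        rw [← ENNReal.ofReal_natCast]; push_cast; rfl
      rw [h1, h2]
      norm_num
    rw [e]
    refine ENNReal.ofReal_le_ofReal ?_
    have hpow : q ^ (r - 2) ≤ (q ^ 2)⁻¹ * q ^ r := by
      rw [inv_mul_eq_div, le_div_iff₀ (by positivity), ← pow_add]
      exact pow_le_pow_of_le_one hq0.le hq1.le (by omega)
    have hr0 : (0 : ℝ) ≤ r := r.cast_nonneg
    have hM0 : (0 : ℝ) ≤ M := M.cast_nonneg
    have hrM : (0 : ℝ) ≤ r * M := by positivity
    have l1 : 6 * (r : ℝ) * M + 1 ≤ (6 * M + 1) * (r + 1) := by nlinarith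
    have l2 : 2 * (r : ℝ) * M + 1 ≤ (6 * M + 1) * (r + 1) := by nlinarith
    calc (6 * (r : ℝ) * M + 1) * ((2 * r * M + 1) * ((2 * r * M + 1) * (2 * q ^ (r - 2))))
        ≤ ((6 * M + 1) * (r + 1)) * (((6 * M + 1) * (r + 1)) * (((6 * M + 1) * (r + 1)) *
          (2 * ((q ^ 2)⁻¹ * q ^ r)))) := by gcongr
      _ = (6 * M + 1) ^ 3 * 2 * (q ^ 2)⁻¹ * (((r : ℝ) + 1) ^ 3 * q ^ r) := by ring
      _ ≤ (6 * M + 1) ^ 3 * 2 * (q ^ 2)⁻¹ * (C * θ ^ r) :=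
          mul_le_mul_of_nonneg_left (hCb r) (by positivity)
      _ = A * θ ^ r := by rw [hA]; ring
  have hsum : HasSum (fun r : ℕ => A * θ ^ (k + r)) (A / (1 - θ) * θ ^ k) := by
    have := (hasSum_geometric_of_lt_one hθ0.le hθ1).mul_left (A * θ ^ k)
    have e1 : (fun r : ℕ => A * θ ^ (k + r)) = fun r => A * θ ^ k * θ ^ r := by
      ext r; rw [pow_add]; ring
    rw [e1, show A / (1 - θ) * θ ^ k = A * θ ^ k * (1 - θ)⁻¹ by rw [div_eq_mul_inv]; ring]
    exact this
  calc ∫⁻ ω in scaleUnion M E k, f ω ∂P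
      ≤ ∑' r : ℕ, ENNReal.ofReal (A * θ ^ (k + r)) * ∫⁻ ω, f ω ∂P := by
        refine (lintegral_iUnion_le _ _).trans (ENNReal.tsum_le_tsum fun r => ?_)
        refine le_trans ?_ (mul_le_mul_left (hscale (k + r)) _)
        refine (setLIntegral_biUnion_finset_le _ _ f fun t _ =>
          setLIntegral_biUnion_finset_le _ _ f fun m₁ _ =>
          setLIntegral_biUnion_finset_le _ _ f fun m₂ _ => hE (k + r) t m₁ m₂).trans_eq ?_
        simp only [Finset.card_range]
        ring
    _ = ENNReal.ofReal (A / (1 - θ) * θ ^ k) * ∫⁻ ω, f ω ∂P := by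
        rw [ENNReal.tsum_mul_right, ← hsum.tsum_eq,
          ENNReal.ofReal_tsum_of_nonneg (fun r => by positivity) hsum.summable]

section SeenPoints

namespace SchottkySystem

variable {X G : Type*} [Group G]

theorem pathPos_zero (ω : ℤ → G) : pathPos ω 0 = 1 := by
  change forwardWalk ω 0 = 1
  simp [forwardWalk]

variable [MulAction G X] [Countable G] [MeasurableSpace G] [DiscreteMeasurableSpace G] {o : X}

theorem measurableSet_pathPos_inv_smul (m n : ℤ) (s : Set X) :
    MeasurableSet {ω : ℤ → G | (pathPos ω n)⁻¹ • pathPos ω m • o ∈ s} :=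
  ((measurable_pathPos n).prodMk (measurable_pathPos m))
    (MeasurableSet.of_discrete (s := {q : G × G | q.1⁻¹ • q.2 • o ∈ s}))

theorem seenFrom_past {m n : ℤ} (hmn : m ≤ n) :
    SeenFrom (fun ω : ℤ → G => pathPos ω m • o) n (Set.Iic n) where
  dependsOn ω ω' h := by
    have := dependsOn_pathPos_inv_mul hmn fun c hc => h c hc.2
    simp only at this ⊢
    rw [← inv_inj, mul_inv_rev, mul_inv_rev, inv_inv, inv_inv] at this
    rw [← mul_smul, ← mul_smul, this]
  measurableSet := measurableSet_pathPos_inv_smul m n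

theorem seenFrom_future {m n : ℤ} (hnm : n ≤ m) :
    SeenFrom (fun ω : ℤ → G => pathPos ω m • o) n (Set.Ioi n) where
  dependsOn ω ω' h := by
    have := dependsOn_pathPos_inv_mul hnm fun c hc => h c hc.1
    simp only at this ⊢
    rw [← mul_smul, ← mul_smul, this]
  measurableSet := measurableSet_pathPos_inv_smul m n

theorem seenFrom_const (x : X) {n : ℤ} (hn : 0 ≤ n) :
    SeenFrom (fun _ : ℤ → G => x) n (Set.Iic n) where
  dependsOn ω ω' h := by
    have := dependsOn_pathPos_inv_mul hn fun c hc => h c hc.2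
    simp only [pathPos_zero, inv_one, one_mul] at this ⊢
    rw [this]
  measurableSet s := (measurable_pathPos n)
    (MeasurableSet.of_discrete (s := {q : G | q⁻¹ • x ∈ s}))

end SchottkySystem

end SeenPoints

section BadEvents

variable {X G : Type*} [MetricSpace X] [Group G] [MulAction G X] [MeasurableSpace G]
  {o : X} {μ : Measure G} {K D ℓ : ℝ}

namespace SchottkySystem

/-- No block at scale `r` of the forward walk creates a gate separating two reference points from
the positions at times `2 * r * len` and `t`. -/
def forwardFail (S : SchottkySystem o μ K D ℓ) (ξ : ℕ → (ℤ → G) → X) (r t m₁ m₂ : ℕ) :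
    Set (ℤ → G) :=
  {ω | ∀ i ∈ Finset.Ico (r : ℤ) (2 * r), ¬ S.HasGate ω i (ξ m₁ ω) (ξ m₂ ω)
    (pathPos ω (2 * r * S.len : ℕ) • o) (pathPos ω (t : ℤ) • o)}

/-- No block at scale `r` of the backward walk creates a gate separating the positions at times
`- 2 * r * len` and `- t` from two positions of the forward walk. -/
def backwardFail (S : SchottkySystem o μ K D ℓ) (r t m₁ m₂ : ℕ) : Set (ℤ → G) :=
  {ω | ∀ i ∈ Finset.Ico (-(2 * r) : ℤ) (-r), ¬ S.HasGate ω i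
    (pathPos ω (-(2 * r * S.len : ℕ)) • o) (pathPos ω (-(t : ℤ)) • o)
    (pathPos ω (m₁ : ℤ) • o) (pathPos ω (m₂ : ℤ) • o)}

theorem scaleSeparated_of_notMem_forward (S : SchottkySystem o μ K D ℓ) {ξ : ℕ → (ℤ → G) → X}
    {k : ℕ} {ω : ℤ → G} (hω : ω ∉ scaleUnion S.len (S.forwardFail ξ) k) {m₁ m₂ : ℕ}
    (h₁ : m₁ ≤ 2 * k * S.len) (h₂ : m₂ ≤ 2 * k * S.len) :
    ScaleSeparated K D ℓ S.len k (fun n => pathPos ω (n : ℤ) • o) (ξ m₁ ω) (ξ m₂ ω) := by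
  intro r hr t ht ht'
  have hkr : 2 * k * S.len ≤ 2 * r * S.len := by gcongr
  have h : ω ∉ S.forwardFail ξ r t m₁ m₂ := fun h =>
    hω (mem_scaleUnion hr ht ht' (h₁.trans hkr) (h₂.trans hkr) h)
  simp only [forwardFail, Set.mem_ofPred_eq, not_forall, not_not] at h
  obtain ⟨i, hi, hg⟩ := h
  rw [Finset.mem_Ico] at hi
  obtain ⟨α, τ, τ', hτ, hτ', hs⟩ := hg.exists_separates
  obtain ⟨i, rfl⟩ := Int.eq_ofNat_of_zero_le (show 0 ≤ i by omega)
  have hi1 : r ≤ i := by omega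
  have hi2 : i + 1 ≤ 2 * r := by omega
  have hb1 : r * S.len ≤ i * S.len := by gcongr
  have hb2 : i * S.len + S.len ≤ 2 * r * S.len := by
    rw [← Nat.succ_mul]; gcongr
  refine ⟨α, i * S.len + τ, i * S.len + τ', by omega, by omega, by omega, ?_⟩
  push_cast at hs ⊢
  exact hs

theorem scaleSeparated_of_notMem_backward (S : SchottkySystem o μ K D ℓ)
    {k : ℕ} {ω : ℤ → G} (hω : ω ∉ scaleUnion S.len S.backwardFail k) {m₁ m₂ : ℕ}
    (h₁ : m₁ ≤ 2 * k * S.len) (h₂ : m₂ ≤ 2 * k * S.len) :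
    ScaleSeparated K D ℓ S.len k (fun n => pathPos ω (-(n : ℤ)) • o)
      (pathPos ω (m₁ : ℤ) • o) (pathPos ω (m₂ : ℤ) • o) := by
  intro r hr t ht ht'
  have hkr : 2 * k * S.len ≤ 2 * r * S.len := by gcongr
  have h : ω ∉ S.backwardFail r t m₁ m₂ := fun h =>
    hω (mem_scaleUnion hr ht ht' (h₁.trans hkr) (h₂.trans hkr) h)
  simp only [backwardFail, Set.mem_ofPred_eq, not_forall, not_not] at h
  obtain ⟨i, hi, hg⟩ := h
  rw [Finset.mem_Ico] at hi
  obtain ⟨α, τ, τ', hτ, hτ', hs⟩ := hg.exists_separates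
  obtain ⟨i, rfl⟩ : ∃ i' : ℕ, i = -(i' : ℤ) := ⟨i.natAbs, by omega⟩
  have hi1 : r + 1 ≤ i := by omega
  have hi2 : i ≤ 2 * r := by omega
  have hb1 : r * S.len + S.len ≤ i * S.len := by
    rw [← Nat.succ_mul]; gcongr
  have hb2 : i * S.len ≤ 2 * r * S.len := by gcongr
  have e : ∀ τ : ℕ, τ ≤ S.len → -(i : ℤ) * S.len + τ = -((i * S.len - τ : ℕ) : ℤ) := by
    intro τ hτ
    rw [Nat.cast_sub (by omega)]
    push_cast
    ring
  rw [e τ hτ, e τ' hτ'] at hs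
  exact ⟨α, i * S.len - τ', i * S.len - τ, by omega, by omega, by omega, hs.symm⟩

variable [DiscreteMeasurableSpace G] [IsProbabilityMeasure μ]

/-- The probability that a window of blocks creates no gate, conditionally on two steps. -/
theorem setLIntegral_no_gate_le_of_pair (S : SchottkySystem o μ K D ℓ) (T : Finset ℤ)
    {x₁ x₂ y₁ y₂ : (ℤ → G) → X} {f : (ℤ → G) → ℝ≥0∞} (hf : Measurable f) {a b : ℤ}
    (hfab : DependsOn f {a, b})
    (hx₁ : ∀ i ∈ T, SeenFrom x₁ (i * S.len) (Set.Iic (i * S.len)))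
    (hx₂ : ∀ i ∈ T, SeenFrom x₂ (i * S.len) (Set.Iic (i * S.len)))
    (hy₁ : ∀ i ∈ T, SeenFrom y₁ ((i + 1) * S.len) (Set.Ioi ((i + 1) * S.len)))
    (hy₂ : ∀ i ∈ T, SeenFrom y₂ ((i + 1) * S.len) (Set.Ioi ((i + 1) * S.len))) :
    ∫⁻ ω in {ω | ∀ i ∈ T, ¬ S.HasGate ω i (x₁ ω) (x₂ ω) (y₁ ω) (y₂ ω)}, f ω ∂(stepMeasure μ) ≤
      2 * (1 - 30 * S.mass) ^ (T.card - 2) * ∫⁻ ω, f ω ∂(stepMeasure μ) := by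
  classical
  have hlen : (0 : ℤ) < S.len := by exact_mod_cast S.len_pos
  set blk : ℤ → ℤ := fun c => (c - 1) / S.len with hblk
  have hmem : ∀ c i, c ∈ S.block i → i = blk c := by
    intro c i hc
    refine ((Int.ediv_emod_unique hlen (a := c - 1) (r := c - 1 - S.len * i)).2
      ⟨by ring, ?_, ?_⟩).1.symm
    · have := hc.1; linarith
    · have := hc.2; linarith
  set T' := (T.erase (blk a)).erase (blk b) with hT'
  have hsub : T' ⊆ T := (Finset.erase_subset _ _).trans (Finset.erase_subset _ _)
  have hcard : T.card - 2 ≤ T'.card := by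
    rw [hT']
    have h1 := Finset.pred_card_le_card_erase (s := T) (a := blk a)
    have h2 := Finset.pred_card_le_card_erase (s := T.erase (blk a)) (a := blk b)
    omega
  have hf' : ∀ i ∈ T', DependsOn f (S.block i)ᶜ := by
    intro i hi
    refine DependsOn.mono ?_ hfab
    simp only [hT', Finset.mem_erase] at hi
    rintro c (rfl | rfl) hc
    · exact hi.2.1 (hmem _ _ hc)
    · exact hi.1 (hmem _ _ hc)
  refine (lintegral_mono_set ?_).trans ((S.setLIntegral_no_gate_le T' hf hf'
    (fun i hi => hx₁ i (hsub hi)) (fun i hi => hx₂ i (hsub hi)) (fun i hi => hy₁ i (hsub hi))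
    (fun i hi => hy₂ i (hsub hi))).trans ?_)
  · exact fun ω hω i hi => hω i (hsub hi)
  · gcongr 2 * ?_ * _
    exact pow_le_pow_of_le_one zero_le tsub_le_self hcard

variable [Countable G]

theorem setLIntegral_forwardFail_le (S : SchottkySystem o μ K D ℓ) {ξ : ℕ → (ℤ → G) → X}
    (hξ : ∀ m n, 0 ≤ n → SeenFrom (ξ m) n (Set.Iic n)) {f : (ℤ → G) → ℝ≥0∞} (hf : Measurable f)
    {a b : ℤ} (hfab : DependsOn f {a, b}) (r t m₁ m₂ : ℕ) :
    ∫⁻ ω in S.forwardFail ξ r (2 * r * S.len + t) m₁ m₂, f ω ∂(stepMeasure μ) ≤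
      2 * (1 - 30 * S.mass) ^ (r - 2) * ∫⁻ ω, f ω ∂(stepMeasure μ) := by
  have hend : ∀ i ∈ Finset.Ico (r : ℤ) (2 * r), (i + 1) * S.len ≤ (2 * r * S.len : ℕ) := by
    intro i hi
    rw [Finset.mem_Ico] at hi
    push_cast
    gcongr
    omega
  have hstart : ∀ i ∈ Finset.Ico (r : ℤ) (2 * r), 0 ≤ i * S.len := by
    intro i hi
    rw [Finset.mem_Ico] at hi
    have : 0 ≤ i := by omega
    positivity
  have h := S.setLIntegral_no_gate_le_of_pair (Finset.Ico (r : ℤ) (2 * r)) hf hfab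
    (fun i hi => hξ m₁ _ (hstart i hi)) (fun i hi => hξ m₂ _ (hstart i hi))
    (fun i hi => seenFrom_future (o := o) (hend i hi))
    (fun i hi => seenFrom_future (o := o) ((hend i hi).trans
      (show ((2 * r * S.len : ℕ) : ℤ) ≤ (2 * r * S.len + t : ℕ) by push_cast; omega)))
  rwa [Int.card_Ico, show (2 * (r : ℤ) - r).toNat = r by omega] at h

theorem setLIntegral_backwardFail_le (S : SchottkySystem o μ K D ℓ) {f : (ℤ → G) → ℝ≥0∞}
    (hf : Measurable f) {a b : ℤ} (hfab : DependsOn f {a, b}) (r t m₁ m₂ : ℕ) :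
    ∫⁻ ω in S.backwardFail r (2 * r * S.len + t) m₁ m₂, f ω ∂(stepMeasure μ) ≤
      2 * (1 - 30 * S.mass) ^ (r - 2) * ∫⁻ ω, f ω ∂(stepMeasure μ) := by
  have hstart : ∀ i ∈ Finset.Ico (-(2 * r) : ℤ) (-r), -((2 * r * S.len : ℕ) : ℤ) ≤ i * S.len := by
    intro i hi
    rw [Finset.mem_Ico] at hi
    push_cast
    rw [← neg_mul]
    gcongr
    omega
  have hend : ∀ i ∈ Finset.Ico (-(2 * r) : ℤ) (-r), (i + 1) * S.len ≤ 0 := by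
    intro i hi
    rw [Finset.mem_Ico] at hi
    exact mul_nonpos_of_nonpos_of_nonneg (by omega) (by positivity)
  have h := S.setLIntegral_no_gate_le_of_pair (Finset.Ico (-(2 * r) : ℤ) (-r)) hf hfab
    (fun i hi => seenFrom_past (o := o) (hstart i hi))
    (fun i hi => seenFrom_past (o := o) (le_trans
      (show -((2 * r * S.len + t : ℕ) : ℤ) ≤ -((2 * r * S.len : ℕ) : ℤ) by push_cast; omega)
      (hstart i hi)))
    (fun i hi => seenFrom_future (o := o) ((hend i hi).trans (Int.natCast_nonneg m₁)))
    (fun i hi => seenFrom_future (o := o) ((hend i hi).trans (Int.natCast_nonneg m₂)))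
  rwa [Int.card_Ico, show (-(r : ℤ) - -(2 * r)).toNat = r by omega] at h

end SchottkySystem

end BadEvents
end ContractingWalk

/-! ### From exponentially unlikely bad events to moments -/

namespace ContractingWalk

section Moments

/-- If `Z ≤ F k` outside of the `k`-th bad event for every `k ≥ 1`, then the integral of `Z` is
controlled by those of `F (k + 1)` over the `k`-th bad event. The bad events need not be
measurable. -/
theorem lintegral_le_add_tsum {Ω : Type*} [MeasurableSpace Ω] {P : Measure Ω} {B : ℕ → Set Ω}
    {Z : Ω → ℝ≥0∞} {F : ℕ → Ω → ℝ≥0∞} (hF : ∀ k, Measurable (F k))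
    (hZ : ∀ k, 0 < k → ∀ ω ∉ B k, Z ω ≤ F k ω)
    (hB : Filter.Tendsto (fun k => P (B k)) Filter.atTop (nhds 0)) :
    ∫⁻ ω, Z ω ∂P ≤ ∫⁻ ω, F 1 ω ∂P + ∑' k, ∫⁻ ω in B (k + 1), F (k + 2) ω ∂P := by
  have hnull : P (⋂ k, B (k + 1)) = 0 := by
    refine le_antisymm (ge_of_tendsto' (hB.comp (Filter.tendsto_add_atTop_nat 1)) fun k => ?_)
      zero_le
    exact measure_mono (Set.iInter_subset _ k)
  have hcover : (Set.univ : Set Ω) ⊆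
      ((B 1)ᶜ ∪ ⋃ k, (B (k + 1) \ B (k + 2))) ∪ ⋂ k, B (k + 1) := by
    intro ω _
    by_cases h : ω ∈ ⋂ k, B (k + 1)
    · exact Or.inr h
    · left
      classical
      simp only [Set.mem_iInter, not_forall] at h
      by_cases h0 : Nat.find h = 0
      · left
        have := Nat.find_spec h
        rwa [h0] at this
      · right
        obtain ⟨k, hk⟩ := Nat.exists_eq_succ_of_ne_zero h0
        refine Set.mem_iUnion.2 ⟨k, not_not.1 (Nat.find_min h (m := k) (by omega)), ?_⟩
        have := Nat.find_spec h
        rwa [hk] at this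
  calc ∫⁻ ω, Z ω ∂P = ∫⁻ ω in Set.univ, Z ω ∂P := by rw [setLIntegral_univ]
    _ ≤ ∫⁻ ω in ((B 1)ᶜ ∪ ⋃ k, (B (k + 1) \ B (k + 2))) ∪ ⋂ k, B (k + 1), Z ω ∂P :=
        lintegral_mono_set hcover
    _ ≤ (∫⁻ ω in (B 1)ᶜ, Z ω ∂P + ∑' k, ∫⁻ ω in B (k + 1) \ B (k + 2), Z ω ∂P) +
          ∫⁻ ω in ⋂ k, B (k + 1), Z ω ∂P := by
        refine (lintegral_union_le _ _ _).trans ?_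
        gcongr
        refine (lintegral_union_le _ _ _).trans ?_
        gcongr
        exact lintegral_iUnion_le _ _
    _ ≤ ∫⁻ ω, F 1 ω ∂P + ∑' k, ∫⁻ ω in B (k + 1), F (k + 2) ω ∂P := by
        rw [setLIntegral_measure_zero _ _ hnull, add_zero]
        refine add_le_add ?_ (ENNReal.tsum_le_tsum fun k => ?_)
        · exact (setLIntegral_mono (hF 1) fun ω hω => hZ 1 one_pos ω hω).trans
            (setLIntegral_le_lintegral _ _)
        · exact (setLIntegral_mono (hF (k + 2)) fun ω hω => hZ (k + 2) (by omega) ω hω.2).trans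
            (lintegral_mono_set Set.sdiff_subset)

theorem tendsto_ofReal_mul_pow {C θ : ℝ} (hθ : 0 < θ) (hθ1 : θ < 1) :
    Filter.Tendsto (fun k : ℕ => ENNReal.ofReal (C * θ ^ k)) Filter.atTop (nhds 0) := by
  have h := (tendsto_pow_atTop_nhds_zero_of_lt_one hθ.le hθ1).const_mul C
  rw [mul_zero] at h
  simpa using ENNReal.tendsto_ofReal h

/-- Polynomial moments: a random variable bounded by a sum of polynomially many terms (each of
which depends on two coordinates) outside of exponentially unlikely bad events has an integral
controlled by those of the terms. -/
theorem exists_lintegral_le_mul_of_bad {C θ : ℝ} (hC : 0 < C) (hθ : 0 < θ) (hθ1 : θ < 1)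
    (M d : ℕ) :
    ∃ W : ℝ≥0∞, W ≠ ∞ ∧ ∀ {S : Type*} [MeasurableSpace S] (P : Measure (ℤ → S))
      [IsProbabilityMeasure P]
      (B : ℕ → Set (ℤ → S)) (Z : (ℤ → S) → ℝ≥0∞) (f : ℕ → ℕ → (ℤ → S) → ℝ≥0∞) (c : ℝ≥0∞),
      (∀ (h : (ℤ → S) → ℝ≥0∞) (a b : ℤ), Measurable h → DependsOn h {a, b} → ∀ k,
        ∫⁻ ω in B k, h ω ∂P ≤ ENNReal.ofReal (C * θ ^ k) * ∫⁻ ω, h ω ∂P) →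
      (∀ s t, Measurable (f s t)) → (∀ s t, ∃ a b, DependsOn (f s t) {a, b}) →
      (∀ s t, ∫⁻ ω, f s t ω ∂P ≤ c) →
      (∀ k, 0 < k → ∀ ω ∉ B k, Z ω ≤ ((2 * k * M : ℕ) : ℝ≥0∞) ^ d *
        ∑ s ∈ Finset.range (2 * k * M), ∑ t ∈ Finset.range (2 * k * M), f s t ω) →
      ∫⁻ ω, Z ω ∂P ≤ W * c := by
  set m : ℕ → ℕ := fun k => 2 * k * M with hm
  have hsum : Summable fun k : ℕ => ((m (k + 2) : ℕ) : ℝ) ^ (d + 2) * (C * θ ^ (k + 1)) := by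
    have h1 := summable_pow_mul_geometric_of_norm_lt_one (d + 2)
      (show ‖θ‖ < 1 by rwa [Real.norm_of_nonneg hθ.le])
    have h2 := ((summable_nat_add_iff 2).2 h1).mul_left ((2 * M : ℝ) ^ (d + 2) * C * θ⁻¹)
    refine h2.congr fun k => ?_
    simp only [hm]
    push_cast
    rw [pow_succ θ (k + 1), show (2 * ((k : ℝ) + 2) * M) = (2 * M) * (k + 2) by ring,
      mul_pow (2 * (M : ℝ))]
    rw [show (2 * (M : ℝ)) ^ (d + 2) * C * θ⁻¹ * (((k : ℝ) + 2) ^ (d + 2) * (θ ^ (k + 1) * θ)) =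
      (2 * (M : ℝ)) ^ (d + 2) * ((k : ℝ) + 2) ^ (d + 2) * (C * θ ^ (k + 1)) * (θ * θ⁻¹) by ring,
      mul_inv_cancel₀ hθ.ne', mul_one]
  refine ⟨(m 1 : ℝ≥0∞) ^ (d + 2) +
    ENNReal.ofReal (∑' k : ℕ, ((m (k + 2) : ℕ) : ℝ) ^ (d + 2) * (C * θ ^ (k + 1))),
    ENNReal.add_ne_top.2
      ⟨ENNReal.pow_ne_top (ENNReal.natCast_ne_top _), ENNReal.ofReal_ne_top⟩, ?_⟩
  intro S _ P _ B Z f c hB hfm hf hfc hZ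
  set F : ℕ → (ℤ → S) → ℝ≥0∞ := fun k ω => ((m k : ℕ) : ℝ≥0∞) ^ d *
        ∑ s ∈ Finset.range (m k), ∑ t ∈ Finset.range (m k), f s t ω with hF
  have hinner : ∀ k, Measurable fun ω =>
      ∑ s ∈ Finset.range (m k), ∑ t ∈ Finset.range (m k), f s t ω := fun k =>
    Finset.measurable_sum _ fun s _ => Finset.measurable_sum _ fun t _ => hfm s t
  have hFm : ∀ k, Measurable (F k) := fun k => (hinner k).const_mul _
  have key : ∀ (Q : Measure (ℤ → S)) (c' : ℝ≥0∞) (k : ℕ), (∀ s t, ∫⁻ ω, f s t ω ∂Q ≤ c') →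
      ∫⁻ ω, F k ω ∂Q ≤ (m k : ℝ≥0∞) ^ (d + 2) * c' := by
    intro Q c' k h
    rw [hF, lintegral_const_mul _ (hinner k),
      lintegral_finsetSum _ fun s _ => Finset.measurable_sum _ fun t _ => hfm s t, pow_add,
      mul_assoc]
    gcongr
    calc ∑ s ∈ Finset.range (m k), ∫⁻ ω, ∑ t ∈ Finset.range (m k), f s t ω ∂Q
        ≤ ∑ _s ∈ Finset.range (m k), ∑ _t ∈ Finset.range (m k), c' := by
          refine Finset.sum_le_sum fun s _ => ?_
          rw [lintegral_finsetSum _ fun t _ => hfm s t]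
          exact Finset.sum_le_sum fun t _ => h s t
      _ = (m k : ℝ≥0∞) ^ 2 * c' := by
          simp only [Finset.sum_const, Finset.card_range, nsmul_eq_mul]
          ring
  have hPB : Filter.Tendsto (fun k => P (B k)) Filter.atTop (nhds 0) := by
    refine tendsto_of_tendsto_of_tendsto_of_le_of_le tendsto_const_nhds
      (tendsto_ofReal_mul_pow (C := C) hθ hθ1) (fun _ => zero_le) fun k => ?_
    have := hB (fun _ => 1) 0 0 measurable_const (fun _ _ _ => rfl) k
    simpa using this
  refine (lintegral_le_add_tsum hFm hZ hPB).trans ?_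
  rw [add_mul]
  gcongr
  · exact key P c 1 hfc
  · rw [ENNReal.ofReal_tsum_of_nonneg (fun k => by positivity) hsum, ← ENNReal.tsum_mul_right]
    refine ENNReal.tsum_le_tsum fun k => ?_
    refine (key (P.restrict (B (k + 1))) (ENNReal.ofReal (C * θ ^ (k + 1)) * c) (k + 2)
      fun s t => ?_).trans_eq ?_
    · obtain ⟨a, b, hab⟩ := hf s t
      exact (hB _ a b (hfm s t) hab (k + 1)).trans (by gcongr; exact hfc s t)
    · rw [ENNReal.ofReal_mul (p := ((m (k + 2) : ℕ) : ℝ) ^ (d + 2)) (by positivity),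
        ENNReal.ofReal_pow (by positivity), ENNReal.ofReal_natCast, mul_assoc]

theorem lintegral_comp_eval {ι S : Type*} [MeasurableSpace S] {μ : Measure S}
    [IsProbabilityMeasure μ] {h : S → ℝ≥0∞} (hh : Measurable h) (t : ι) :
    ∫⁻ ω, h (ω t) ∂(Measure.infinitePi fun _ : ι => μ) = ∫⁻ g, h g ∂μ :=
  (measurePreserving_eval_infinitePi (fun _ : ι => μ) t).lintegral_comp hh

open Classical in
theorem lintegral_piecewise_comp_eval {ι S : Type*} [MeasurableSpace S] {μ : Measure S}
    [IsProbabilityMeasure μ] {h : S → ℝ≥0∞} (hh : Measurable h) (t : ι) (ω : ι → S) :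
    ∫⁻ ω', h ((({t} : Set ι).piecewise ω' ω) t) ∂(Measure.infinitePi fun _ : ι => μ) =
      ∫⁻ g, h g ∂μ := by
  simp only [Set.piecewise_eq_of_mem _ _ _ (Set.mem_singleton t)]
  exact lintegral_comp_eval hh t

theorem lintegral_mul_eval_le {ι S : Type*} [MeasurableSpace S] {μ : Measure S}
    [IsProbabilityMeasure μ] {h₁ h₂ : S → ℝ≥0∞} (m₁ : Measurable h₁) (m₂ : Measurable h₂)
    {s t : ι} (hst : s ≠ t) :
    ∫⁻ ω, h₁ (ω s) * h₂ (ω t) ∂(Measure.infinitePi fun _ : ι => μ) ≤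
      (∫⁻ g, h₂ g ∂μ) * ∫⁻ g, h₁ g ∂μ := by
  have := lintegral_mul_le_of_resample (μ := μ) (J := ({t} : Set ι)) (f := fun ω => h₁ (ω s))
    (φ := fun ω => h₂ (ω t)) (c := ∫⁻ g, h₂ g ∂μ) (m₁.comp (measurable_pi_apply s))
    (m₂.comp (measurable_pi_apply t)) (fun ω ω' h => by simp only [h s hst])
    (fun ω => (lintegral_piecewise_comp_eval m₂ t ω).le)
  rwa [lintegral_comp_eval m₁] at this

theorem lintegral_prod_eval_le {S : Type*} [MeasurableSpace S] {μ : Measure S}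
    [IsProbabilityMeasure μ] {h : S → ℝ≥0∞} (hh : Measurable h) (n : ℕ) :
    ∫⁻ ω, ∏ t ∈ Finset.range n, h (ω ((t : ℤ) + 1)) ∂(Measure.infinitePi fun _ : ℤ => μ) ≤
      (∫⁻ g, h g ∂μ) ^ n := by
  have := lintegral_mul_prod_le (μ := μ) (Finset.range n)
    (J := fun t : ℕ => ({(t : ℤ) + 1} : Set ℤ))
    (f := fun _ => 1) (φ := fun t ω => h (ω ((t : ℤ) + 1))) (c := ∫⁻ g, h g ∂μ) measurable_const
    (fun t _ => hh.comp (measurable_pi_apply _)) (fun _ _ _ _ _ => rfl)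
    (fun i _ i' _ hlt ω ω' h' => by
      simp only [h' ((i' : ℤ) + 1) (by
        simp only [Set.mem_compl_iff, Set.mem_singleton_iff]; omega)])
    (fun t _ ω => (lintegral_piecewise_comp_eval hh ((t : ℤ) + 1) ω).le)
  simpa using this

/-- Exponential moments: a random variable bounded by a product of independent factors outside of
exponentially unlikely bad events is integrable if the factors are close enough to `1`. By the
Cauchy–Schwarz inequality, the `k`-th bad event contributes `s⁻¹ ^ k` times the square root of its
probability `(s ^ 4) ^ k`, up to constants. -/
theorem exists_lintegral_le_of_bad {C s : ℝ} (hC : 0 < C) (hs : 0 < s) (hs1 : s < 1) (M : ℕ) :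
    ∃ W : ℝ≥0∞, W ≠ ∞ ∧ ∀ {S : Type*} [MeasurableSpace S] (μ : Measure S) [IsProbabilityMeasure μ]
      (B : ℕ → Set (ℤ → S)) (Z : (ℤ → S) → ℝ≥0∞) (h : S → ℝ≥0∞),
      (∀ k, Measure.infinitePi (fun _ : ℤ => μ) (B k) ≤ ENNReal.ofReal (C * (s ^ 4) ^ k)) →
      Measurable h → (∫⁻ g, h g ^ 2 ∂μ) ^ M ≤ ENNReal.ofReal s⁻¹ →
      (∀ k, 0 < k → ∀ ω ∉ B k, Z ω ≤ ∏ t ∈ Finset.range (2 * k * M), h (ω ((t : ℤ) + 1))) →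
      ∫⁻ ω, Z ω ∂(Measure.infinitePi fun _ : ℤ => μ) ≤ W := by
  have hsum : Summable fun k : ℕ => √C * s ^ k :=
    (summable_geometric_of_lt_one hs.le hs1).mul_left _
  refine ⟨ENNReal.ofReal s⁻¹ + ENNReal.ofReal (∑' k : ℕ, √C * s ^ k),
    ENNReal.add_ne_top.2 ⟨ENNReal.ofReal_ne_top, ENNReal.ofReal_ne_top⟩, ?_⟩
  intro S _ μ _ B Z h hB hh hM hZ
  set F : ℕ → (ℤ → S) → ℝ≥0∞ := fun k ω => ∏ t ∈ Finset.range (2 * k * M), h (ω ((t : ℤ) + 1))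
    with hF
  have hFm : ∀ k, Measurable (F k) := fun k =>
    Finset.measurable_prod _ fun t _ => hh.comp (measurable_pi_apply _)
  set P := Measure.infinitePi (fun _ : ℤ => μ) with hP
  have hPB : Filter.Tendsto (fun k => P (B k)) Filter.atTop (nhds 0) :=
    tendsto_of_tendsto_of_tendsto_of_le_of_le tendsto_const_nhds
      (tendsto_ofReal_mul_pow (C := C) (pow_pos hs 4) (pow_lt_one₀ hs.le hs1 (by norm_num)))
      (fun _ => zero_le) hB
  -- Cauchy–Schwarz
  have hCS : ∀ (E : Set (ℤ → S)) (k : ℕ), ∫⁻ ω in E, F k ω ∂P ≤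
      ENNReal.ofReal s⁻¹ ^ k * P E ^ (1 / 2 : ℝ) := by
    intro E k
    have h1 := ENNReal.lintegral_mul_le_Lp_mul_Lq (P.restrict E) Real.HolderConjugate.two_two
      (hFm k).aemeasurable (measurable_const (a := (1 : ℝ≥0∞))).aemeasurable
    simp only [Pi.mul_apply, mul_one, ENNReal.one_rpow, lintegral_const, one_mul,
      Measure.restrict_apply_univ] at h1
    refine h1.trans ?_
    gcongr
    have h2 : ∫⁻ ω in E, F k ω ^ (2 : ℝ) ∂P ≤ (∫⁻ g, h g ^ 2 ∂μ) ^ (2 * k * M) := by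
      refine (setLIntegral_le_lintegral _ _).trans ?_
      refine le_trans (le_of_eq ?_) (lintegral_prod_eval_le (hh.pow_const 2) (2 * k * M))
      refine lintegral_congr fun ω => ?_
      rw [hF, Finset.prod_pow, ← ENNReal.rpow_natCast]
      norm_num
    calc (∫⁻ ω in E, F k ω ^ (2 : ℝ) ∂P) ^ (1 / 2 : ℝ)
        ≤ ((∫⁻ g, h g ^ 2 ∂μ) ^ (2 * k * M)) ^ (1 / 2 : ℝ) := by gcongr
      _ = ((∫⁻ g, h g ^ 2 ∂μ) ^ M) ^ k := by
          rw [← ENNReal.rpow_natCast, ← ENNReal.rpow_mul, ← pow_mul, ← ENNReal.rpow_natCast]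
          congr 1
          push_cast
          ring
      _ ≤ ENNReal.ofReal s⁻¹ ^ k := by gcongr
  refine (lintegral_le_add_tsum hFm hZ hPB).trans ?_
  gcongr
  · have := hCS Set.univ 1
    rw [setLIntegral_univ, measure_univ, ENNReal.one_rpow, mul_one, pow_one] at this
    exact this
  · rw [ENNReal.ofReal_tsum_of_nonneg (fun k => by positivity) hsum]
    refine ENNReal.tsum_le_tsum fun k => (hCS _ _).trans ?_
    have h1 : P (B (k + 1)) ^ (1 / 2 : ℝ) ≤ ENNReal.ofReal (√C * s ^ (2 * (k + 1))) := by
      calc P (B (k + 1)) ^ (1 / 2 : ℝ)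
          ≤ (ENNReal.ofReal (C * (s ^ 4) ^ (k + 1))) ^ (1 / 2 : ℝ) := by gcongr; exact hB _
        _ = ENNReal.ofReal (√C * s ^ (2 * (k + 1))) := by
          rw [ENNReal.ofReal_rpow_of_nonneg (by positivity) (by norm_num), ← Real.sqrt_eq_rpow,
            Real.sqrt_mul hC.le]
          congr 2
          rw [← pow_mul, show 4 * (k + 1) = 2 * (k + 1) * 2 by ring, pow_mul,
            Real.sqrt_sq (by positivity)]
    refine (mul_le_mul_right h1 _).trans_eq ?_
    rw [← ENNReal.ofReal_pow (by positivity), ← ENNReal.ofReal_mul (by positivity)]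
    congr 1
    rw [show 2 * (k + 1) = k + (k + 2) by ring, pow_add s k, inv_pow]
    field_simp

/-- Jensen's inequality for concave powers. -/
theorem lintegral_rpow_le {S : Type*} [MeasurableSpace S] {μ : Measure S} [IsProbabilityMeasure μ]
    {f : S → ℝ≥0∞} (hf : Measurable f) {r : ℝ} (hr : 0 < r) (hr1 : r < 1) :
    ∫⁻ g, f g ^ r ∂μ ≤ (∫⁻ g, f g ∂μ) ^ r := by
  have h1 := ENNReal.lintegral_mul_le_Lp_mul_Lq μ
    (Real.HolderConjugate.conjExponent (p := r⁻¹) ((one_lt_inv₀ hr).2 hr1))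
    (hf.pow_const r).aemeasurable (measurable_const (a := (1 : ℝ≥0∞))).aemeasurable
  simpa [← ENNReal.rpow_mul, mul_inv_cancel₀ hr.ne'] using h1

theorem rpow_sum_le {p : ℝ} (hp : 0 < p) {d : ℕ} (hpd : p ≤ d) (m : ℕ) {b : ℕ → ℝ}
    (hb : ∀ t, 0 ≤ b t) :
    ENNReal.ofReal ((∑ t ∈ Finset.range m, b t) ^ p) ≤
      (m : ℝ≥0∞) ^ d * ∑ t ∈ Finset.range m, ENNReal.ofReal (b t ^ p) := by
  rcases Nat.eq_zero_or_pos m with rfl | hm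
  · simp [Real.zero_rpow hp.ne']
  obtain ⟨t, ht, hmax⟩ := Finset.exists_max_image (Finset.range m) b ⟨0, Finset.mem_range.2 hm⟩
  have h1 : (∑ t ∈ Finset.range m, b t) ^ p ≤ (m : ℝ) ^ d * b t ^ p := by
    calc (∑ t ∈ Finset.range m, b t) ^ p ≤ (m * b t) ^ p := by
          refine Real.rpow_le_rpow (Finset.sum_nonneg fun t _ => hb t) ?_ hp.le
          simpa using Finset.sum_le_card_nsmul _ _ _ hmax
      _ = (m : ℝ) ^ p * b t ^ p := Real.mul_rpow (by positivity) (hb t)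
      _ ≤ (m : ℝ) ^ d * b t ^ p := by
          refine mul_le_mul_of_nonneg_right ?_ (Real.rpow_nonneg (hb t) _)
          rw [← Real.rpow_natCast]
          exact Real.rpow_le_rpow_of_exponent_le (by exact_mod_cast hm) hpd
  refine (ENNReal.ofReal_le_ofReal h1).trans ?_
  rw [ENNReal.ofReal_mul (by positivity), ENNReal.ofReal_pow (by positivity),
    ENNReal.ofReal_natCast]
  gcongr
  exact Finset.single_le_sum (f := fun t => ENNReal.ofReal (b t ^ p)) (fun _ _ => zero_le) ht

end Moments
end ContractingWalk

/-! ### Gromov products along the walk -/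

namespace ContractingWalk

section GromovProduct

variable {X : Type*} [MetricSpace X]

theorem gromovProduct_nonneg (x y z : X) : 0 ≤ gromovProduct x y z := by
  have := dist_triangle_left y z x
  rw [gromovProduct]
  linarith

theorem gromovProduct_comm (x y z : X) : gromovProduct x y z = gromovProduct x z y := by
  rw [gromovProduct, gromovProduct, dist_comm y z]
  ring

theorem gromovProduct_le_of_dist_add_dist_le {o x q q' : X} {c : ℝ} (hc : 0 ≤ c)
    (h : dist x q' + dist q' q ≤ dist x q + c) : gromovProduct o q x ≤ dist o q' + c := by
  have h1 := dist_triangle o q' q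
  have h2 := dist_triangle_right o x q'
  rw [gromovProduct, dist_comm q x]
  linarith

end GromovProduct

section Displacement

variable {X G : Type*} [MetricSpace X] [Group G] [MulAction G X] [IsIsometricSMul G X]

theorem dist_pathPos_natCast_smul_le (o : X) (ω : ℤ → G) (n : ℕ) :
    dist o (pathPos ω (n : ℤ) • o) ≤ ∑ t ∈ Finset.range n, dist o (ω ((t : ℤ) + 1) • o) := by
  induction n with
  | zero => simp [SchottkySystem.pathPos_zero]
  | succ n ih =>
    rw [Finset.sum_range_succ, Nat.cast_succ, pathPos_add_one, mul_smul]
    have h := dist_triangle o (pathPos ω (n : ℤ) • o) (pathPos ω (n : ℤ) • ω ((n : ℤ) + 1) • o)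
    rw [dist_smul] at h
    linarith

theorem dist_pathPos_neg_natCast_smul_le (o : X) (ω : ℤ → G) (n : ℕ) :
    dist o (pathPos ω (-(n : ℤ)) • o) ≤ ∑ t ∈ Finset.range n, dist o (ω (-(t : ℤ)) • o) := by
  induction n with
  | zero => simp [SchottkySystem.pathPos_zero]
  | succ n ih =>
    have e := pathPos_add_one ω (-((n + 1 : ℕ) : ℤ))
    rw [show -((n + 1 : ℕ) : ℤ) + 1 = -(n : ℤ) by push_cast; ring] at e
    rw [e, mul_smul] at ih
    have h := dist_triangle o (pathPos ω (-((n + 1 : ℕ) : ℤ)) • ω (-(n : ℤ)) • o)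
      (pathPos ω (-((n + 1 : ℕ) : ℤ)) • o)
    rw [dist_smul, dist_comm (ω (-(n : ℤ)) • o) o] at h
    rw [Finset.sum_range_succ]
    linarith

theorem sum_range_add_const_le {b : ℕ → ℝ} (hb : ∀ t, 0 ≤ b t) {c : ℝ} (hc : 0 ≤ c) {i m : ℕ}
    (him : i ≤ m) (hm : 0 < m) :
    ∑ t ∈ Finset.range i, b t + c ≤ ∑ t ∈ Finset.range m, (b t + c) := by
  rw [Finset.sum_add_distrib]
  refine add_le_add (Finset.sum_le_sum_of_subset_of_nonneg (Finset.range_mono him)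
    fun t _ _ => hb t) ?_
  rw [Finset.sum_const, Finset.card_range, nsmul_eq_mul]
  exact le_mul_of_one_le_left hc (by exact_mod_cast hm)

end Displacement

namespace SchottkySystem

variable {X G : Type*} [MetricSpace X] [Group G] [MulAction G X] [MeasurableSpace G]
  {o : X} {μ : Measure G} {K D ℓ : ℝ}

/-- The upper bound, up to an additive constant, for the displacement of a step in the estimates
of Gromov products. -/
noncomputable def stepLength (_S : SchottkySystem o μ K D ℓ) (g : G) : ℝ :=
  dist o (g • o) + (2 * D + 40 * K)

theorem error_nonneg (S : SchottkySystem o μ K D ℓ) : 0 ≤ 2 * D + 40 * K := by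
  have h1 := S.K_pos
  have h2 := S.D_nonneg
  linarith

theorem stepLength_nonneg (S : SchottkySystem o μ K D ℓ) (g : G) : 0 ≤ S.stepLength g :=
  add_nonneg dist_nonneg S.error_nonneg

/-- The event that some scale `r ≥ k` does not separate `x` from the forward walk. -/
def oneSidedBad (S : SchottkySystem o μ K D ℓ) (x : X) (k : ℕ) : Set (ℤ → G) :=
  scaleUnion S.len (S.forwardFail fun _ _ => x) k

/-- The event that some scale `r ≥ k` does not separate the forward walk from the backward one, on
one of the two sides. -/
def twoSidedBad (S : SchottkySystem o μ K D ℓ) (k : ℕ) : Set (ℤ → G) :=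
  scaleUnion S.len (S.forwardFail fun m ω => pathPos ω (-(m : ℤ)) • o) k ∪
    scaleUnion S.len S.backwardFail k

theorem exists_setLIntegral_bad_le [Countable G] [DiscreteMeasurableSpace G]
    [IsProbabilityMeasure μ] (S : SchottkySystem o μ K D ℓ) :
    ∃ C θ : ℝ, 0 < C ∧ 0 < θ ∧ θ < 1 ∧ ∀ (f : (ℤ → G) → ℝ≥0∞) (a b : ℤ), Measurable f →
      DependsOn f {a, b} → ∀ k,
      (∀ x, ∫⁻ ω in S.oneSidedBad x k, f ω ∂(stepMeasure μ) ≤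
        ENNReal.ofReal (C * θ ^ k) * ∫⁻ ω, f ω ∂(stepMeasure μ)) ∧
      ∫⁻ ω in S.twoSidedBad k, f ω ∂(stepMeasure μ) ≤
        ENNReal.ofReal (C * θ ^ k) * ∫⁻ ω, f ω ∂(stepMeasure μ) := by
  have h50 : 50 * S.mass ≤ 1 := S.mass_le
  have hmass : S.mass ≠ 0 := S.mass_ne_zero
  have hρ0 : 1 - 30 * S.mass ≠ 0 := by
    intro h
    have h1 : 1 ≤ 30 * S.mass := tsub_eq_zero_iff_le.1 h
    have h2 : 50 * S.mass ≤ 30 * S.mass := h50.trans h1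
    have hfin : S.mass ≠ ∞ := by
      rintro h
      rw [h] at h50
      norm_num at h50
    rw [ENNReal.mul_le_mul_iff_left hmass hfin] at h2
    norm_num at h2
  have hρ1 : 1 - 30 * S.mass < 1 :=
    ENNReal.sub_lt_self ENNReal.one_ne_top one_ne_zero (mul_ne_zero (by norm_num) hmass)
  obtain ⟨C, θ, hC, hθ, hθ1, h⟩ := exists_setLIntegral_scaleUnion_le hρ0 hρ1 S.len
  refine ⟨2 * C, θ, by positivity, hθ, hθ1, fun f a b hf hab k => ⟨fun x => ?_, ?_⟩⟩
  · refine (h (stepMeasure μ) (S.forwardFail fun _ _ => x) f (fun r t m₁ m₂ =>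
      S.setLIntegral_forwardFail_le (fun _ n hn => seenFrom_const x hn) hf hab r t m₁ m₂)
        k).trans ?_
    gcongr
    linarith
  · have h1 := h (stepMeasure μ) (S.forwardFail fun m ω => pathPos ω (-(m : ℤ)) • o) f
      (fun r t m₁ m₂ => S.setLIntegral_forwardFail_le
        (fun m n hn => seenFrom_past (by omega)) hf hab r t m₁ m₂) k
    have h2 := h (stepMeasure μ) S.backwardFail f
      (fun r t m₁ m₂ => S.setLIntegral_backwardFail_le hf hab r t m₁ m₂) k
    refine (lintegral_union_le _ _ _).trans ((add_le_add h1 h2).trans_eq ?_)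
    rw [← two_mul, mul_assoc 2 C, ENNReal.ofReal_mul zero_le_two, ENNReal.ofReal_ofNat, mul_assoc]

variable [IsIsometricSMul G X]

theorem dist_add_le_sum_stepLength (S : SchottkySystem o μ K D ℓ) (ω : ℤ → G) {i m : ℕ}
    (him : i ≤ m) (hm : 0 < m) :
    dist o (pathPos ω (i : ℤ) • o) + (2 * D + 40 * K) ≤
      ∑ t ∈ Finset.range m, S.stepLength (ω ((t : ℤ) + 1)) := by
  have h1 := dist_pathPos_natCast_smul_le o ω i
  have h2 := sum_range_add_const_le (b := fun t : ℕ => dist o (ω ((t : ℤ) + 1) • o))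
    (fun _ => dist_nonneg) S.error_nonneg him hm
  simp only [stepLength]
  linarith

theorem dist_neg_add_le_sum_stepLength (S : SchottkySystem o μ K D ℓ) (ω : ℤ → G) {i m : ℕ}
    (him : i ≤ m) (hm : 0 < m) :
    dist o (pathPos ω (-(i : ℤ)) • o) + (2 * D + 40 * K) ≤
      ∑ t ∈ Finset.range m, S.stepLength (ω (-(t : ℤ))) := by
  have h1 := dist_pathPos_neg_natCast_smul_le o ω i
  have h2 := sum_range_add_const_le (b := fun t : ℕ => dist o (ω (-(t : ℤ)) • o))
    (fun _ => dist_nonneg) S.error_nonneg him hm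
  simp only [stepLength]
  linarith

theorem gromovProduct_le_of_notMem_oneSidedBad (S : SchottkySystem o μ K D ℓ)
    (hX : IsGeodesicSpace X) {x : X} {k : ℕ} (hk : 0 < k) {ω : ℤ → G}
    (hω : ω ∉ S.oneSidedBad x k) (n : ℕ) :
    gromovProduct o (forwardWalk ω n • o) x ≤
      ∑ t ∈ Finset.range (2 * k * S.len), S.stepLength (ω ((t : ℤ) + 1)) := by
  have hpos : 0 < 2 * k * S.len := Nat.mul_pos (by omega) S.len_pos
  obtain ⟨i, hi, h⟩ := (S.scaleSeparated_of_notMem_forward hω (Nat.zero_le _)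
    (Nat.zero_le _)).exists_dist_add_dist_le hX S.K_pos S.D_nonneg S.lt_ℓ S.len_pos hk n
  exact (gromovProduct_le_of_dist_add_dist_le S.error_nonneg h).trans
    (S.dist_add_le_sum_stepLength ω hi hpos)

theorem gromovProduct_le_of_notMem_twoSidedBad (S : SchottkySystem o μ K D ℓ)
    (hX : IsGeodesicSpace X) {k : ℕ} (hk : 0 < k) {ω : ℤ → G}
    (hω : ω ∉ S.twoSidedBad k) (n n' : ℕ) :
    gromovProduct o (backwardWalk ω n' • o) (forwardWalk ω n • o) ≤
        ∑ t ∈ Finset.range (2 * k * S.len), S.stepLength (ω ((t : ℤ) + 1)) ∧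
      gromovProduct o (backwardWalk ω n' • o) (forwardWalk ω n • o) ≤
        ∑ t ∈ Finset.range (2 * k * S.len), S.stepLength (ω (-(t : ℤ))) := by
  have hpos : 0 < 2 * k * S.len := Nat.mul_pos (by omega) S.len_pos
  have h₁ : ω ∉ scaleUnion S.len (S.forwardFail fun m ω => pathPos ω (-(m : ℤ)) • o) k :=
    fun h => hω (Or.inl h)
  have h₂ : ω ∉ scaleUnion S.len S.backwardFail k := fun h => hω (Or.inr h)
  have H : ∀ m₁ ≤ 2 * k * S.len, ∀ m₂ ≤ 2 * k * S.len, ScaleSeparated K D ℓ S.len k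
      (fun n => pathPos ω (n : ℤ) • o) (pathPos ω (-(m₁ : ℤ)) • o) (pathPos ω (-(m₂ : ℤ)) • o) :=
    fun m₁ hm₁ m₂ hm₂ => S.scaleSeparated_of_notMem_forward h₁ hm₁ hm₂
  have H' : ∀ m₁ ≤ 2 * k * S.len, ∀ m₂ ≤ 2 * k * S.len, ScaleSeparated K D ℓ S.len k
      (fun n => pathPos ω (-(n : ℤ)) • o) (pathPos ω (m₁ : ℤ) • o) (pathPos ω (m₂ : ℤ) • o) :=
    fun m₁ hm₁ m₂ hm₂ => S.scaleSeparated_of_notMem_backward h₂ hm₁ hm₂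
  constructor
  · obtain ⟨i, hi, h⟩ := exists_dist_add_dist_le_of_scaleSeparated hX S.K_pos S.D_nonneg S.lt_ℓ
      S.len_pos hk (Q := fun n : ℕ => pathPos ω (n : ℤ) • o)
      (Q' := fun n : ℕ => pathPos ω (-(n : ℤ)) • o) H H' n n'
    rw [gromovProduct_comm, ← pathPos_neg_natCast]
    exact (gromovProduct_le_of_dist_add_dist_le S.error_nonneg h).trans
      (S.dist_add_le_sum_stepLength ω hi hpos)
  · obtain ⟨i, hi, h⟩ := exists_dist_add_dist_le_of_scaleSeparated hX S.K_pos S.D_nonneg S.lt_ℓ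
      S.len_pos hk (Q := fun n : ℕ => pathPos ω (-(n : ℤ)) • o)
      (Q' := fun n : ℕ => pathPos ω (n : ℤ) • o) H' H n' n
    rw [← pathPos_neg_natCast]
    exact (gromovProduct_le_of_dist_add_dist_le S.error_nonneg h).trans
      (S.dist_neg_add_le_sum_stepLength ω hi hpos)

end SchottkySystem
end ContractingWalk

/-! ### The deviation inequality -/

namespace ContractingWalk
namespace SchottkySystem

variable {X G : Type*} [MetricSpace X] [Group G] [MulAction G X] [MeasurableSpace G]
  {o : X} {μ : Measure G} {K D ℓ : ℝ}

theorem lintegral_stepLength_rpow_lt_top [DiscreteMeasurableSpace G] [IsProbabilityMeasure μ]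
    (S : SchottkySystem o μ K D ℓ) {p : ℝ} (hp : 0 < p) (h : HasFiniteMoment o μ p) :
    ∫⁻ g, ENNReal.ofReal (S.stepLength g ^ p) ∂μ < ∞ := by
  set c := 2 * D + 40 * K with hc
  have hc0 : 0 ≤ c := S.error_nonneg
  have hle : ∀ g : G, ENNReal.ofReal (S.stepLength g ^ p) ≤
      ENNReal.ofReal (2 ^ p) * (ENNReal.ofReal (dist o (g • o) ^ p) + ENNReal.ofReal (c ^ p)) := by
    intro g
    have h0 : 0 ≤ dist o (g • o) := dist_nonneg
    rw [← ENNReal.ofReal_add (by positivity) (by positivity), ← ENNReal.ofReal_mul (by positivity)]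
    refine ENNReal.ofReal_le_ofReal ?_
    have h1 : S.stepLength g ≤ 2 * max (dist o (g • o)) c := by
      rw [stepLength]
      linarith [le_max_left (dist o (g • o)) c, le_max_right (dist o (g • o)) c]
    refine (Real.rpow_le_rpow (S.stepLength_nonneg g) h1 hp.le).trans ?_
    rw [Real.mul_rpow zero_le_two (le_max_of_le_left h0)]
    refine mul_le_mul_of_nonneg_left ?_ (by positivity)
    have h2 : 0 ≤ dist o (g • o) ^ p := by positivity
    have h3 : 0 ≤ c ^ p := by positivity
    rcases max_choice (dist o (g • o)) c with e | e <;> rw [e] <;> linarith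
  refine (lintegral_mono hle).trans_lt ?_
  rw [lintegral_const_mul _ (Measurable.of_discrete), lintegral_add_right _ measurable_const,
    lintegral_const, measure_univ, mul_one]
  exact ENNReal.mul_lt_top ENNReal.ofReal_lt_top (ENNReal.add_lt_top.2 ⟨h, ENNReal.ofReal_lt_top⟩)

/-- Polynomial moments of Gromov products along the walk. The exponent doubles in the two-sided
case because the Gromov product is bounded by two sums of displacements, one over positive times
and one over nonpositive times, which are independent. -/
theorem exists_lintegral_iSup_rpow_le [Countable G] [DiscreteMeasurableSpace G]
    [IsProbabilityMeasure μ] [IsIsometricSMul G X] (S : SchottkySystem o μ K D ℓ)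
    (hX : IsGeodesicSpace X) {p : ℝ} (hp : 0 < p) (h : HasFiniteMoment o μ p) :
    ∃ W : ℝ≥0∞, W ≠ ∞ ∧ ∀ x : X,
      ∫⁻ g, ⨆ n : ℕ, ENNReal.ofReal (gromovProduct o (forwardWalk g n • o) x ^ p)
        ∂(stepMeasure μ) ≤ W ∧
      ∫⁻ g, ⨆ (n : ℕ) (n' : ℕ), ENNReal.ofReal
        (gromovProduct o (backwardWalk g n' • o) (forwardWalk g n • o) ^ (2 * p))
        ∂(stepMeasure μ) ≤ W := by
  obtain ⟨C, θ, hC, hθ, hθ1, hbad⟩ := S.exists_setLIntegral_bad_le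
  set d := ⌈p⌉₊ with hd
  have hpd : p ≤ d := Nat.le_ceil p
  obtain ⟨W₁, hW₁, h₁⟩ := exists_lintegral_le_mul_of_bad hC hθ hθ1 S.len d
  obtain ⟨W₂, hW₂, h₂⟩ := exists_lintegral_le_mul_of_bad hC hθ hθ1 S.len (2 * d)
  set φ : G → ℝ≥0∞ := fun g => ENNReal.ofReal (S.stepLength g ^ p) with hφ
  have hφm : Measurable φ := Measurable.of_discrete
  set c : ℝ≥0∞ := ∫⁻ g, φ g ∂μ with hc
  have hcfin : c ≠ ∞ := (S.lintegral_stepLength_rpow_lt_top hp h).ne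
  refine ⟨W₁ * c + W₂ * (c * c), ENNReal.add_ne_top.2 ⟨ENNReal.mul_ne_top hW₁ hcfin,
    ENNReal.mul_ne_top hW₂ (ENNReal.mul_ne_top hcfin hcfin)⟩, fun x => ⟨?_, ?_⟩⟩
  · refine le_trans ?_ le_self_add
    refine h₁ (stepMeasure μ) (S.oneSidedBad x) _ (fun _ t ω => φ (ω ((t : ℤ) + 1))) c
      (fun f a b hf hab k => (hbad f a b hf hab k).1 x)
      (fun s t => hφm.comp (measurable_pi_apply _))
      (fun s t => ⟨(t : ℤ) + 1, (t : ℤ) + 1, fun ω ω' e => ?_⟩)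
      (fun s t => (lintegral_comp_eval hφm _).le) fun k hk ω hω => iSup_le fun n => ?_
    · have e1 := e ((t : ℤ) + 1) (by simp)
      simp only [e1]
    · refine (ENNReal.ofReal_le_ofReal (Real.rpow_le_rpow (gromovProduct_nonneg _ _ _)
        (S.gromovProduct_le_of_notMem_oneSidedBad hX hk hω n) hp.le)).trans ?_
      refine (rpow_sum_le hp hpd _ fun t => S.stepLength_nonneg _).trans ?_
      refine mul_le_mul' le_rfl ?_
      have hpos : 0 < 2 * k * S.len := Nat.mul_pos (by omega) S.len_pos
      exact Finset.single_le_sum (f := fun _ : ℕ => ∑ t ∈ Finset.range (2 * k * S.len),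
        φ (ω ((t : ℤ) + 1))) (fun _ _ => zero_le) (Finset.mem_range.2 hpos)
  · refine le_trans ?_ le_add_self
    refine h₂ (stepMeasure μ) S.twoSidedBad _
      (fun s t ω => φ (ω ((t : ℤ) + 1)) * φ (ω (-(s : ℤ)))) (c * c)
      (fun f a b hf hab k => (hbad f a b hf hab k).2)
      (fun s t => (hφm.comp (measurable_pi_apply _)).mul (hφm.comp (measurable_pi_apply _)))
      (fun s t => ⟨(t : ℤ) + 1, -(s : ℤ), fun ω ω' e => ?_⟩)
      (fun s t => lintegral_mul_eval_le hφm hφm (by omega))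
      fun k hk ω hω => iSup_le fun n => iSup_le fun n' => ?_
    · have e1 := e ((t : ℤ) + 1) (by simp)
      have e2 := e (-(s : ℤ)) (by simp)
      simp only [e1, e2]
    · obtain ⟨b₁, b₂⟩ := S.gromovProduct_le_of_notMem_twoSidedBad hX hk hω n n'
      have h0 := gromovProduct_nonneg o (backwardWalk ω n' • o) (forwardWalk ω n • o)
      have l₁ := rpow_sum_le hp hpd (2 * k * S.len)
        (b := fun t : ℕ => S.stepLength (ω ((t : ℤ) + 1))) fun t => S.stepLength_nonneg _
      have l₂ := rpow_sum_le hp hpd (2 * k * S.len)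
        (b := fun t : ℕ => S.stepLength (ω (-(t : ℤ)))) fun t => S.stepLength_nonneg _
      rw [two_mul p, Real.rpow_add_of_nonneg h0 hp.le hp.le, ENNReal.ofReal_mul (by positivity)]
      have l₃ := mul_le_mul'
        ((ENNReal.ofReal_le_ofReal (Real.rpow_le_rpow h0 b₁ hp.le)).trans l₁)
        ((ENNReal.ofReal_le_ofReal (Real.rpow_le_rpow h0 b₂ hp.le)).trans l₂)
      refine l₃.trans_eq ?_
      rw [mul_mul_mul_comm, ← pow_add, ← two_mul, Finset.sum_mul_sum, Finset.sum_comm]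

/-- A finite exponential moment gives exponential moments arbitrarily close to `1`. -/
theorem exists_lintegral_exp_stepLength_pow_le [DiscreteMeasurableSpace G]
    [IsProbabilityMeasure μ] (S : SchottkySystem o μ K D ℓ) (h : HasFiniteExpMoment o μ) {b : ℝ}
    (hb : 1 < b) (M : ℕ) :
    ∃ κ : ℝ, 0 < κ ∧
      (∫⁻ g, ENNReal.ofReal (Real.exp (κ * S.stepLength g)) ^ 2 ∂μ) ^ M ≤ ENNReal.ofReal b := by
  obtain ⟨c₀, hc₀, h⟩ := h
  set f : G → ℝ≥0∞ := fun g => ENNReal.ofReal (Real.exp (c₀ * S.stepLength g)) with hf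
  have hfm : Measurable f := Measurable.of_discrete
  have hfin : ∫⁻ g, f g ∂μ < ∞ := by
    have e : ∀ g, f g = ENNReal.ofReal (Real.exp (c₀ * (2 * D + 40 * K))) *
        ENNReal.ofReal (Real.exp (c₀ * dist o (g • o))) := by
      intro g
      rw [← ENNReal.ofReal_mul (by positivity), ← Real.exp_add, ← mul_add, add_comm]
      rfl
    simp_rw [e]
    rw [lintegral_const_mul _ (Measurable.of_discrete)]
    exact ENNReal.mul_lt_top ENNReal.ofReal_lt_top h
  set e : ℝ := max 1 (∫⁻ g, f g ∂μ).toReal with he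
  have he1 : 1 ≤ e := le_max_left _ _
  have hfe : ∫⁻ g, f g ∂μ ≤ ENNReal.ofReal e := by
    rw [← ENNReal.ofReal_toReal hfin.ne]
    exact ENNReal.ofReal_le_ofReal (le_max_right _ _)
  have hlog : 0 ≤ Real.log e := Real.log_nonneg he1
  have hlogb : 0 < Real.log b := Real.log_pos hb
  -- the exponent is chosen such that `e ^ (r * M) ≤ b`
  set r : ℝ := min (1 / 2) (Real.log b / (M * Real.log e + 1)) with hr
  have hden : 0 < M * Real.log e + 1 := by positivity
  have hr0 : 0 < r := lt_min (by norm_num) (div_pos hlogb hden)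
  have hr1 : r < 1 := (min_le_left _ _).trans_lt (by norm_num)
  refine ⟨c₀ * r / 2, by positivity, ?_⟩
  have e2 : ∀ g, ENNReal.ofReal (Real.exp (c₀ * r / 2 * S.stepLength g)) ^ 2 = f g ^ r := by
    intro g
    rw [hf, ENNReal.ofReal_rpow_of_pos (Real.exp_pos _), ← ENNReal.ofReal_pow (by positivity),
      ← Real.exp_mul, ← Real.exp_nat_mul]
    congr 2
    push_cast
    ring
  simp_rw [e2]
  calc (∫⁻ g, f g ^ r ∂μ) ^ M ≤ ((ENNReal.ofReal e) ^ r) ^ M := by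
        gcongr
        exact (lintegral_rpow_le hfm hr0 hr1).trans (ENNReal.rpow_le_rpow hfe hr0.le)
    _ = ENNReal.ofReal ((e ^ r) ^ M) := by
        rw [ENNReal.ofReal_rpow_of_pos (by linarith), ENNReal.ofReal_pow (by positivity)]
    _ ≤ ENNReal.ofReal b := by
        refine ENNReal.ofReal_le_ofReal ?_
        rw [← Real.rpow_mul_natCast (by linarith), Real.rpow_def_of_pos (by linarith),
          ← Real.le_log_iff_exp_le (by linarith)]
        have h1 : r * (M * Real.log e + 1) ≤ Real.log b := by
          rw [← le_div_iff₀ hden]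
          exact min_le_right _ _
        nlinarith

/-- Exponential moments of Gromov products along the walk. -/
theorem exists_lintegral_iSup_exp_le [Countable G] [DiscreteMeasurableSpace G]
    [IsProbabilityMeasure μ] [IsIsometricSMul G X] (S : SchottkySystem o μ K D ℓ)
    (hX : IsGeodesicSpace X) (h : HasFiniteExpMoment o μ) :
    ∃ κ : ℝ, 0 < κ ∧ ∃ W : ℝ≥0∞, W ≠ ∞ ∧ ∀ x : X,
      ∫⁻ g, ⨆ n : ℕ, ENNReal.ofReal
        (Real.exp (κ * gromovProduct o x (forwardWalk g n • o))) ∂(stepMeasure μ) ≤ W ∧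
      ∫⁻ g, ⨆ (n : ℕ) (n' : ℕ), ENNReal.ofReal
        (Real.exp (κ * gromovProduct o (backwardWalk g n' • o) (forwardWalk g n • o)))
        ∂(stepMeasure μ) ≤ W := by
  obtain ⟨C, θ, hC, hθ, hθ1, hbad⟩ := S.exists_setLIntegral_bad_le
  set s : ℝ := θ ^ (1 / 4 : ℝ) with hs
  have hs0 : 0 < s := by positivity
  have hs1 : s < 1 := Real.rpow_lt_one hθ.le hθ1 (by norm_num)
  have hs4 : s ^ 4 = θ := by
    rw [hs, ← Real.rpow_mul_natCast hθ.le]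
    norm_num
  obtain ⟨W, hW, hWb⟩ := exists_lintegral_le_of_bad hC hs0 hs1 S.len
  obtain ⟨κ, hκ, hκM⟩ := S.exists_lintegral_exp_stepLength_pow_le h ((one_lt_inv₀ hs0).2 hs1) S.len
  have hprob : ∀ k,
      (∀ x, stepMeasure μ (S.oneSidedBad x k) ≤ ENNReal.ofReal (C * (s ^ 4) ^ k)) ∧
      stepMeasure μ (S.twoSidedBad k) ≤ ENNReal.ofReal (C * (s ^ 4) ^ k) := by
    intro k
    have := hbad (fun _ => 1) 0 0 measurable_const (fun _ _ _ => rfl) k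
    simpa [hs4] using this
  have hprod : ∀ (ω : ℤ → G) (m : ℕ) (y : ℝ),
      y ≤ ∑ t ∈ Finset.range m, S.stepLength (ω ((t : ℤ) + 1)) →
      ENNReal.ofReal (Real.exp (κ * y)) ≤ ∏ t ∈ Finset.range m,
        ENNReal.ofReal (Real.exp (κ * S.stepLength (ω ((t : ℤ) + 1)))) := by
    intro ω m y hy
    rw [← ENNReal.ofReal_prod_of_nonneg fun _ _ => (Real.exp_pos _).le, ← Real.exp_sum,
      ← Finset.mul_sum]
    gcongr
  refine ⟨κ, hκ, W, hW, fun x => ⟨?_, ?_⟩⟩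
  · refine hWb μ (S.oneSidedBad x) _ _ (fun k => (hprob k).1 x) Measurable.of_discrete hκM
      fun k hk ω hω => iSup_le fun n => hprod ω _ _ ?_
    rw [gromovProduct_comm]
    exact S.gromovProduct_le_of_notMem_oneSidedBad hX hk hω n
  · exact hWb μ S.twoSidedBad _ _ (fun k => (hprob k).2) Measurable.of_discrete hκM
      fun k hk ω hω => iSup_le fun n => iSup_le fun n' => hprod ω _ _
        (S.gromovProduct_le_of_notMem_twoSidedBad hX hk hω n n').1

end SchottkySystem

theorem lt_ofReal_toReal_add_one {W a : ℝ≥0∞} (hW : W ≠ ∞) (h : a ≤ W) :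
    a < ENNReal.ofReal (W.toReal + 1) :=
  h.trans_lt ((ENNReal.lt_ofReal_iff_toReal_lt hW).2 (lt_add_one _))

end ContractingWalk

theorem theorem1p1 {X G : Type*} [MetricSpace X] (hX : ContractingWalk.IsGeodesicSpace X)
    [Group G] [Countable G] [MulAction G X] [IsIsometricSMul G X]
    [MeasurableSpace G] [DiscreteMeasurableSpace G]
    (o : X) (μ : Measure G) [IsProbabilityMeasure μ]
    (hμ : ContractingWalk.IsNonElementary o μ) :
    (∀ p : ℝ, 0 < p → ContractingWalk.HasFiniteMoment o μ p →
      ∃ K : ℝ, 0 < K ∧ ∀ x : X,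
        ∫⁻ g, ⨆ n : ℕ, ENNReal.ofReal
            (ContractingWalk.gromovProduct o (ContractingWalk.forwardWalk g n • o) x ^ p)
          ∂(ContractingWalk.stepMeasure μ) < ENNReal.ofReal K ∧
        ∫⁻ g, ⨆ (n : ℕ) (n' : ℕ), ENNReal.ofReal
            (ContractingWalk.gromovProduct o (ContractingWalk.backwardWalk g n' • o)
              (ContractingWalk.forwardWalk g n • o) ^ (2 * p))
          ∂(ContractingWalk.stepMeasure μ) < ENNReal.ofReal K) ∧
    (ContractingWalk.HasFiniteExpMoment o μ →
      ∃ κ K : ℝ, 0 < κ ∧ 0 < K ∧ ∀ x : X,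
        ∫⁻ g, ⨆ n : ℕ, ENNReal.ofReal (Real.exp
            (κ * ContractingWalk.gromovProduct o x (ContractingWalk.forwardWalk g n • o)))
          ∂(ContractingWalk.stepMeasure μ) < ENNReal.ofReal K ∧
        ∫⁻ g, ⨆ (n : ℕ) (n' : ℕ), ENNReal.ofReal (Real.exp
            (κ * ContractingWalk.gromovProduct o (ContractingWalk.backwardWalk g n' • o)
              (ContractingWalk.forwardWalk g n • o)))
          ∂(ContractingWalk.stepMeasure μ) < ENNReal.ofReal K) := by
  obtain ⟨K, D, ℓ, ⟨S⟩⟩ := ContractingWalk.exists_schottkySystem hX hμ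
  refine ⟨fun p hp h => ?_, fun h => ?_⟩
  · obtain ⟨W, hW, hb⟩ := S.exists_lintegral_iSup_rpow_le hX hp h
    exact ⟨W.toReal + 1, by positivity, fun x =>
      ⟨ContractingWalk.lt_ofReal_toReal_add_one hW (hb x).1,
        ContractingWalk.lt_ofReal_toReal_add_one hW (hb x).2⟩⟩
  · obtain ⟨κ, hκ, W, hW, hb⟩ := S.exists_lintegral_iSup_exp_le hX h
    exact ⟨κ, W.toReal + 1, hκ, by positivity, fun x =>
      ⟨ContractingWalk.lt_ofReal_toReal_add_one hW (hb x).1,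
        ContractingWalk.lt_ofReal_toReal_add_one hW (hb x).2⟩⟩
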